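/- Let $K$ be a field of characteristic $0$ and let $\mathfrak g=\bigoplus_{p\in\mathbb Z}\mathfrak g_p$ be a finite-dimensional $\mathbb Z$-graded Lie algebra over $K$, i.e. $[\mathfrak g_p,\mathfrak g_q]\subseteq\mathfrak g_{p+q}$ for all $p,q\in\mathbb Z$. Let $\mathfrak n$ be its maximal nilpotent ideal (the sum of all ideals of $\mathfrak g$ that are nilpotent as Lie algebras). Then there are a finite-dimensional $\mathbb Z$-graded $K$-vector space $V=\bigoplus_{q\in\mathbb Z}V_q$ and an injective Lie algebra homomorphism $\rho\colon\mathfrak g\to\mathfrak{gl}_K(V)$ such that $$\rho(X)(V_q)\subseteq V_{p+q}\qquad\text{for all } p,q\in\mathbb Z,\ X\in\mathfrak g_p,$$ and $\rho(X)$ is a nilpotent endomorphism of $V$ for every $X\in\mathfrak n$. -/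

import Mathlib

universe u v

attribute [local instance] LieRing.ofAssociativeRing

namespace GradedAdo

/-- The maximal nilpotent ideal of a Lie algebra: the sum of all ideals which are nilpotent as Lie
algebras. (Mathlib's `LieAlgebra.maxNilpotentIdeal` is different: it is built from the ideals on
which the *whole* of `L` acts nilpotently.) -/
def nilradical (K L : Type*) [CommRing K] [LieRing L] [LieAlgebra K L] : LieIdeal K L :=
  sSup {I : LieIdeal K L | LieRing.IsNilpotent I}

/-- `ρ` is a `ℤ`-graded linear representation, on the vector space `V` with `ℤ`-gradation `𝒱`, of
the `ℤ`-graded Lie algebra `L = ⨁ₚ ℒ p`: the spaces `𝒱 q` form a direct sum decomposition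
of `V`, and `ρ(ℒ p)(𝒱 q) ⊆ 𝒱 (p + q)`. -/
structure IsGradedRepresentation {K L V : Type*} [Field K] [LieRing L] [LieAlgebra K L]
    [AddCommGroup V] [Module K V] (ℒ : ℤ → Submodule K L) (𝒱 : ℤ → Submodule K V)
    (ρ : L →ₗ⁅K⁆ Module.End K V) : Prop where
  isInternal : DirectSum.IsInternal 𝒱
  map_mem : ∀ (p q : ℤ), ∀ x ∈ ℒ p, ∀ v ∈ 𝒱 q, ρ x v ∈ 𝒱 (p + q)

section Nilradical

variable {K L : Type*} [Field K] [LieRing L] [LieAlgebra K L]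

theorem isNilpotent_ideal_iff [FiniteDimensional K L] (I : LieIdeal K L) :
    LieRing.IsNilpotent I ↔ ∃ k, I.lcs L k = ⊥ := by
  have h1 : LieModule.IsNilpotent I L ↔ ∃ k, I.lcs L k = ⊥ := by
    rw [LieModule.isNilpotent_iff K]
    refine exists_congr fun k => ?_
    rw [← LieSubmodule.toSubmodule_inj, ← LieSubmodule.toSubmodule_inj, LieIdeal.coe_lcs_eq]
    rfl
  rw [← h1]
  constructor
  · intro h
    rw [LieModule.isNilpotent_iff_forall (R := K)]
    intro x
    obtain ⟨k, hk⟩ := LieAlgebra.nilpotent_ad_of_nilpotent_algebra K I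
    have key : ∀ (n : ℕ) (y : I), ((LieAlgebra.ad K I x ^ n) y : L)
        = (LieModule.toEnd K I L x ^ n) (y : L) := by
      intro n
      induction n with
      | zero => intro y; rfl
      | succ n ih =>
        intro y
        rw [pow_succ, pow_succ, Module.End.mul_apply, Module.End.mul_apply, ih]
        rfl
    refine ⟨k + 1, LinearMap.ext fun y => ?_⟩
    have hy : ⁅(x : L), y⁆ ∈ I := lie_mem_left K L I x y x.2
    have := key k ⟨_, hy⟩
    rw [hk x] at this
    rw [pow_succ, Module.End.mul_apply]
    exact this.symm
  · intro h
    rw [LieAlgebra.isNilpotent_iff_forall (R := K)]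
    intro x
    obtain ⟨k, hk⟩ := LieModule.isNilpotent_toEnd_of_isNilpotent K I L x
    refine ⟨k, LinearMap.ext fun y => Subtype.ext ?_⟩
    have key : ∀ (n : ℕ) (y : I), ((LieAlgebra.ad K I x ^ n) y : L)
        = (LieModule.toEnd K I L x ^ n) (y : L) := by
      intro n
      induction n with
      | zero => intro y; rfl
      | succ n ih =>
        intro y
        rw [pow_succ, pow_succ, Module.End.mul_apply, Module.End.mul_apply, ih]
        rfl
    rw [key, hk]
    rfl

theorem le_lcs_of_le_lie (I : LieIdeal K L) (N A : LieIdeal K L) (h : N ≤ ⁅I, N⁆ ⊔ A) (k : ℕ) :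
    N ≤ I.lcs L k ⊔ A := by
  induction k with
  | zero => simp
  | succ k ih =>
    rw [LieIdeal.lcs_succ]
    refine h.trans (sup_le ?_ le_sup_right)
    refine (LieSubmodule.mono_lie_right _ ih).trans ?_
    rw [LieSubmodule.lie_sup]
    exact sup_le_sup le_rfl (LieSubmodule.lie_le_right _ _)

theorem isNilpotent_sup [FiniteDimensional K L] {I J : LieIdeal K L}
    (hI : LieRing.IsNilpotent I) (hJ : LieRing.IsNilpotent J) :
    LieRing.IsNilpotent (I ⊔ J : LieIdeal K L) := by
  rw [isNilpotent_ideal_iff] at *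
  obtain ⟨k, hk⟩ := hI
  obtain ⟨l, hl⟩ := hJ
  have hanti : Antitone fun n => (I ⊔ J : LieIdeal K L).lcs L n :=
    antitone_nat_of_succ_le fun n => by
      rw [LieIdeal.lcs_succ]; exact LieSubmodule.lie_le_right _ _
  have : WellFoundedLT (LieSubmodule K L L) := LieSubmodule.wellFoundedLT_of_isArtinian K L L
  obtain ⟨n, hn⟩ := WellFoundedGT.monotone_chain_condition
    (α := (LieSubmodule K L L)ᵒᵈ) ⟨fun n => (I ⊔ J : LieIdeal K L).lcs L n, hanti⟩
  refine ⟨n, ?_⟩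
  have hN := hn (n + 1) (Nat.le_succ n)
  change (I ⊔ J : LieIdeal K L).lcs L n = (I ⊔ J : LieIdeal K L).lcs L (n + 1) at hN
  rw [LieIdeal.lcs_succ] at hN
  generalize (I ⊔ J : LieIdeal K L).lcs L n = N at hN
  rw [LieSubmodule.sup_lie] at hN
  have h1 := le_lcs_of_le_lie J N ⁅I, N⁆ (by rw [sup_comm]; exact hN.le) l
  rw [hl, bot_sup_eq] at h1
  have h2 := le_lcs_of_le_lie I N ⊥ (by simpa using h1) k
  rw [hk] at h2
  simpa using h2

/-- In finite dimension the nilradical is nilpotent, and contains all nilpotent ideals. -/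
theorem isGreatest_nilradical [FiniteDimensional K L] :
    IsGreatest {I : LieIdeal K L | LieRing.IsNilpotent I} (nilradical K L) := by
  refine ⟨?_, fun I hI => le_sSup hI⟩
  have hwf := CompleteLattice.WellFoundedGT.isSupClosedCompact (LieSubmodule K L L) inferInstance
  refine hwf {I : LieIdeal K L | LieRing.IsNilpotent I} ⟨⊥, ?_⟩ fun I hI J hJ => ?_
  · exact (isNilpotent_ideal_iff (⊥ : LieIdeal K L)).2 ⟨1, by simp [LieIdeal.lcs_succ]⟩
  · exact isNilpotent_sup hI hJ

end Nilradical

end GradedAdo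

/-! Adjoin to the graded algebra an element acting as the Euler derivation, which is multiplication
by `p` in degree `p`. Ado's theorem gives a faithful finite-dimensional representation of this
semidirect sum; let `T` be the image of the new element. For `X` of degree `p` one has `[T, ρ X] = p
ρ X`, so `ρ X` moves the generalized eigenspace of `T` for `λ` to that for `λ + p`. A grading of `V`
therefore only needs an integer `d(λ)` with `d(λ + p) = d(λ) + p`. Eigenvalues may lie outside `K`,
so `d` is defined on polynomials (`exists_degree_taylor`), and primary components of `T` replace
generalized eigenspaces (`isInternal_primaryPart`, `map_mem_primaryPart`).

Ado's theorem also makes the nilradical of the semidirect sum act nilpotently. It contains the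
original nilradical as soon as the Euler derivation preserves the latter (`inl_mem_nilradical`).
This follows by interpolation from invariance under the automorphism scaling degree `p` by `2 ^ p`
(`eulerDerivation_mem_nilradical`).

For Ado's theorem itself it is enough to be faithful on the center, since the adjoint representation
can be added. The tool is Zassenhaus extension from an ideal `a` to `a ⋊ h`
(`exists_extension_representation`): `a` acts on its enveloping algebra by left multiplication, `h`
by derivations, and an `h`-stable ideal of finite codimension is divided out. It climbs through
ideals of codimension one inside the radical (`exists_representation_solvable`), then from the
radical to the whole algebra along a Levi decomposition (`exists_section_of_ker_isSolvable`). The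
inclusion of `[L, rad L]` in the nilradical (`lie_mem_nilradical`) supplies the hypotheses. -/

namespace GradedAdo

/-! ### Consequences of Lie's theorem: the bracket with a solvable ideal acts nilpotently -/

section LieTheorem

open LieModule Module

/-- If all elements of a submodule are mapped to it by `f`, and `f` is nilpotent on it and on the
quotient, then `f` is nilpotent. -/
theorem isNilpotent_of_restrict_of_mapQ {K V : Type*} [CommRing K] [AddCommGroup V] [Module K V]
    (f : End K V) (W : Submodule K V) (k l : ℕ)
    (hk : ∀ v, (f ^ k) v ∈ W) (hl : ∀ w ∈ W, (f ^ l) w = 0) : IsNilpotent f := by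
  refine ⟨l + k, LinearMap.ext fun v => ?_⟩
  rw [pow_add, End.mul_apply, hl _ (hk v)]
  rfl

/-- Lie's theorem gives a weight `χ` of `I` whose weight space is nonzero, and it is stable under
`L` in characteristic zero. There `⁅x, a⁆` is a scalar and also a commutator, so its trace vanishes
and `χ ⁅x, a⁆ = 0`. Hence `y` kills this submodule, and induction handles the quotient. -/
theorem isNilpotent_toEnd_of_isAlgClosed {K L : Type*} [Field K] [CharZero K] [IsAlgClosed K]
    [LieRing L] [LieAlgebra K L] (I : LieIdeal K L) [LieAlgebra.IsSolvable I]
    {y : L} (hy : y ∈ (⁅(⊤ : LieIdeal K L), I⁆ : LieIdeal K L)) (n : ℕ) :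
    ∀ (M : Type v) [AddCommGroup M] [Module K M] [LieRingModule L M] [LieModule K L M]
      [FiniteDimensional K M], finrank K M = n → IsNilpotent (toEnd K L M y) := by
  induction n using Nat.strong_induction_on with
  | _ n ih =>
  intro M _ _ _ _ _ hn
  rcases subsingleton_or_nontrivial M with h | h
  · exact ⟨1, Subsingleton.elim _ _⟩
  obtain ⟨χ, hχ⟩ := exists_nontrivial_weightSpace_of_isSolvable K I M
  let N : LieSubmodule K L M := weightSpaceOfIsLieTower K M χ
  have hN : Nontrivial N := hχ
  have hsc (a : I) (m : M) (hm : m ∈ N) : ⁅(a : L), m⁆ = χ a • m := by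
    have : m ∈ weightSpace M χ := hm
    exact (mem_weightSpace _ _).1 this a
  have hχ0 : ∀ x : L, ∀ a : I, ∀ m ∈ N, ⁅⁅x, (a : L)⁆, m⁆ = 0 := by
    intro x a m hm
    have h1 : toEnd K L N ⁅x, (a : L)⁆ = χ ⟨⁅x, (a : L)⁆, lie_mem_right K L I x a a.2⟩ • 1 := by
      ext m
      simpa using hsc ⟨⁅x, (a : L)⁆, lie_mem_right K L I x a a.2⟩ m m.2
    have h2 : LinearMap.trace K N (toEnd K L N ⁅x, (a : L)⁆) = 0 := by
      rw [LieHom.map_lie, LieRing.of_associative_ring_bracket, map_sub, LinearMap.trace_mul_comm,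
        sub_self]
    rw [h1, map_smul, LinearMap.trace_one, smul_eq_mul, mul_eq_zero] at h2
    have h3 : χ ⟨⁅x, (a : L)⁆, lie_mem_right K L I x a a.2⟩ = 0 := by
      refine h2.resolve_right ?_
      exact_mod_cast (finrank_pos (R := K) (M := N)).ne'
    have := hsc ⟨⁅x, (a : L)⁆, lie_mem_right K L I x a a.2⟩ m hm
    rwa [h3, zero_smul] at this
  have hy0 : ∀ m ∈ N, ⁅y, m⁆ = 0 := by
    intro m hm
    have : y ∈ LinearMap.ker ((toEnd K L M : L →ₗ[K] End K M).flip m) := by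
      revert hy
      change y ∈ (⁅(⊤ : LieIdeal K L), I⁆ : LieIdeal K L).toSubmodule → _
      rw [LieSubmodule.lieIdeal_oper_eq_linear_span']
      intro hy
      refine Submodule.span_le.2 ?_ hy
      rintro _ ⟨x, -, a, ha, rfl⟩
      exact hχ0 x ⟨a, ha⟩ m hm
    exact this
  have hlt : finrank K (M ⧸ N) < n := by
    have h1 := Submodule.finrank_quotient_add_finrank N.toSubmodule
    have h2 : 0 < finrank K N.toSubmodule := finrank_pos (R := K) (M := N)
    change finrank K (M ⧸ N.toSubmodule) < n
    omega
  obtain ⟨k, hk⟩ := ih _ hlt (M ⧸ N) rfl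
  refine isNilpotent_of_restrict_of_mapQ _ N.toSubmodule k 1 ?_ ?_
  · intro m
    have key : ∀ j : ℕ, LieSubmodule.Quotient.mk' N ((toEnd K L M y ^ j) m)
        = (toEnd K L (M ⧸ N) y ^ j) (LieSubmodule.Quotient.mk' N m) := by
      intro j
      induction j with
      | zero => rfl
      | succ j ihj =>
        rw [pow_succ', pow_succ', End.mul_apply, End.mul_apply, ← ihj, toEnd_apply_apply,
          toEnd_apply_apply, LieModuleHom.map_lie]
    have := key k
    rw [hk, LinearMap.zero_apply, LieSubmodule.Quotient.mk_eq_zero] at this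
    exact this
  · intro m hm
    simpa using hy0 m hm

open scoped TensorProduct in
/-- If `I` is a solvable ideal of `L`, then `⁅L, I⁆` acts nilpotently on every finite-dimensional
representation of `L`. -/
theorem isNilpotent_toEnd_of_mem_lie {K L : Type*} [Field K] [CharZero K]
    [LieRing L] [LieAlgebra K L] (I : LieIdeal K L) [LieAlgebra.IsSolvable I]
    (M : Type*) [AddCommGroup M] [Module K M] [LieRingModule L M] [LieModule K L M]
    [FiniteDimensional K M]
    {y : L} (hy : y ∈ (⁅(⊤ : LieIdeal K L), I⁆ : LieIdeal K L)) :
    IsNilpotent (toEnd K L M y) := by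
  let A := AlgebraicClosure K
  have hI : LieAlgebra.IsSolvable (I.baseChange A : LieIdeal A (A ⊗[K] L)) := by
    obtain ⟨k, hk⟩ := LieAlgebra.IsSolvable.solvable K I
    refine LieAlgebra.IsSolvable.mk (R := A) (k := k) ?_
    rw [LieIdeal.derivedSeries_eq_bot_iff] at hk ⊢
    rw [LieAlgebra.derivedSeriesOfIdeal_baseChange, hk, LieSubmodule.baseChange_bot]
  have hyA : (1 : A) ⊗ₜ[K] y ∈
      (⁅(⊤ : LieIdeal A (A ⊗[K] L)), (I.baseChange A : LieIdeal A (A ⊗[K] L))⁆ :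
        LieIdeal A (A ⊗[K] L)) := by
    have := LieSubmodule.tmul_mem_baseChange_of_mem (1 : A) hy
    rwa [LieSubmodule.lie_baseChange, LieSubmodule.baseChange_top] at this
  have h := isNilpotent_toEnd_of_isAlgClosed (I.baseChange A : LieIdeal A (A ⊗[K] L)) hyA _
    (A ⊗[K] M) rfl
  rw [toEnd_baseChange] at h
  exact (IsNilpotent.map_iff (f := End.baseChangeHom K A M)
    (LinearMap.baseChangeHom_injective K M A)).1 h

/-- By the previous result for the adjoint representation, every element of this ideal is
ad-nilpotent; Engel's theorem makes the ideal nilpotent. -/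
theorem lie_mem_nilradical {K L : Type*} [Field K] [CharZero K]
    [LieRing L] [LieAlgebra K L] [FiniteDimensional K L] (I : LieIdeal K L)
    [LieAlgebra.IsSolvable I] : (⁅(⊤ : LieIdeal K L), I⁆ : LieIdeal K L) ≤ nilradical K L := by
  refine (isGreatest_nilradical (K := K) (L := L)).2 ?_
  rw [Set.mem_ofPred_eq, isNilpotent_ideal_iff]
  have : LieModule.IsNilpotent (⁅(⊤ : LieIdeal K L), I⁆ : LieIdeal K L) L := by
    rw [LieModule.isNilpotent_iff_forall (R := K)]
    intro y
    exact isNilpotent_toEnd_of_mem_lie I L y.2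
  obtain ⟨k, hk⟩ := (LieModule.isNilpotent_iff K _ _).1 this
  refine ⟨k, ?_⟩
  rw [← LieSubmodule.toSubmodule_inj, LieIdeal.coe_lcs_eq, hk]
  rfl

end LieTheorem

/-! ### Products of subspaces of finite codimension in a finitely generated algebra -/

section FiniteCodimension

variable {K U : Type*} [Field K] [Ring U] [Algebra K U]

theorem finite_quotient_of_fg_sup_eq_top {I C : Submodule K U} (hC : C.FG) (h : C ⊔ I = ⊤) :
    Module.Finite K (U ⧸ I) := by
  refine ⟨?_⟩
  have : C.map I.mkQ = ⊤ := by
    have h1 : (C ⊔ I).map I.mkQ = ⊤ := by rw [h, Submodule.map_top, Submodule.range_mkQ]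
    rwa [Submodule.map_sup, Submodule.mkQ_map_self, sup_bot_eq] at h1
  rw [← this]
  exact hC.map _

theorem exists_fg_sup_eq_top (I : Submodule K U) [Module.Finite K (U ⧸ I)] :
    ∃ C : Submodule K U, C.FG ∧ C ⊔ I = ⊤ := by
  obtain ⟨C, hC⟩ := I.exists_isCompl
  refine ⟨C, ?_, hC.symm.sup_eq_top⟩
  have := Module.Finite.equiv (I.quotientEquivOfIsCompl C hC)
  exact Module.Finite.iff_fg.1 this

/-- In a finitely generated algebra, the product of a right ideal of finite codimension with a
subspace of finite codimension has finite codimension. -/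
theorem finite_quotient_mul {S : Submodule K U} (hS : S.FG)
    (hgen : Algebra.adjoin K (S : Set U) = ⊤) {I J : Submodule K U} (hI : I * ⊤ ≤ I)
    [Module.Finite K (U ⧸ I)] [Module.Finite K (U ⧸ J)] : Module.Finite K (U ⧸ (I * J)) := by
  obtain ⟨C₀, hC₀, hC₀I⟩ := exists_fg_sup_eq_top I
  obtain ⟨B, hB, hBJ⟩ := exists_fg_sup_eq_top J
  have hone : (1 : Submodule K U).FG := by
    rw [Submodule.one_eq_span]; exact Submodule.fg_span_singleton _
  have hCI : C₀ ⊔ 1 ⊔ I = ⊤ := by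
    rw [sup_right_comm, hC₀I, top_sup_eq]
  have hC : (C₀ ⊔ 1).FG := hC₀.sup hone
  have h1C : 1 ≤ C₀ ⊔ 1 := le_sup_right
  generalize C₀ ⊔ 1 = C at hCI hC h1C
  -- A finite-dimensional generating space for the right ideal `I`: `C + F U` contains `1` and is
  -- stable under right multiplication by the generators `S`, so it is everything, which forces `I =
  -- F U`. Then `U = C + F (B + J)` lies in `C + F B + I J`.
  let F : Submodule K U := (C * S ⊔ C) ⊓ I
  have hF : F.FG := by
    have : FiniteDimensional K (C * S ⊔ C : Submodule K U) :=
      Module.Finite.iff_fg.2 ((hC.mul hS).sup hC)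
    exact Module.Finite.iff_fg.1 (Submodule.finiteDimensional_of_le inf_le_left)
  have hFI : F * ⊤ ≤ I := (mul_le_mul' inf_le_right le_rfl).trans hI
  have hFle : F ≤ F * ⊤ := by
    intro x hx
    simpa using Submodule.mul_mem_mul hx (Submodule.mem_top (x := (1 : U)))
  have hCS : C * S ≤ C ⊔ F * ⊤ := by
    intro x hx
    have hx' : x ∈ C ⊔ I := by rw [hCI]; trivial
    obtain ⟨c, hc, i, hi, rfl⟩ := Submodule.mem_sup.1 hx'
    refine Submodule.add_mem_sup hc (hFle ⟨?_, hi⟩)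
    have : i = (c + i) + -c := by abel
    rw [this]
    exact Submodule.add_mem_sup hx (C.neg_mem hc)
  have hR : C ⊔ F * ⊤ = ⊤ := by
    have hS' : ∀ s ∈ S, ∀ x ∈ C ⊔ F * ⊤, x * s ∈ C ⊔ F * ⊤ := by
      intro s hs x hx
      have : (C ⊔ F * ⊤) * S ≤ C ⊔ F * ⊤ := by
        rw [Submodule.sup_mul, mul_assoc]
        exact sup_le hCS (le_sup_of_le_right (mul_le_mul' le_rfl le_top))
      exact this (Submodule.mul_mem_mul hx hs)
    have hall : ∀ u : U, ∀ x ∈ C ⊔ F * ⊤, x * u ∈ C ⊔ F * ⊤ := by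
      intro u
      have hu : u ∈ Algebra.adjoin K (S : Set U) := by rw [hgen]; trivial
      induction hu using Algebra.adjoin_induction with
      | mem s hs => exact hS' s hs
      | algebraMap c =>
        intro x hx
        rw [← Algebra.commutes, ← Algebra.smul_def]
        exact Submodule.smul_mem _ _ hx
      | add a b _ _ ha hb => intro x hx; rw [mul_add]; exact add_mem (ha x hx) (hb x hx)
      | mul a b _ _ ha hb => intro x hx; rw [← mul_assoc]; exact hb _ (ha x hx)
    refine eq_top_iff.2 fun u _ => ?_
    have := hall u 1 (le_sup_of_le_left h1C (Submodule.one_le.1 le_rfl))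
    rwa [one_mul] at this
  have hIF : I ≤ F * ⊤ := by
    intro x hx
    have hx' : x ∈ C ⊔ F * ⊤ := by rw [hR]; trivial
    obtain ⟨c, hc, f, hf, rfl⟩ := Submodule.mem_sup.1 hx'
    refine add_mem (hFle ⟨le_sup_right (a := C * S) hc, ?_⟩) hf
    have : c = (c + f) - f := by abel
    rw [this]
    exact sub_mem hx (hFI hf)
  refine finite_quotient_of_fg_sup_eq_top (C := C ⊔ F * B) (hC.sup (hF.mul hB)) ?_
  refine eq_top_iff.2 ?_
  calc ⊤ = C ⊔ I := hCI.symm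
    _ ≤ C ⊔ F * (B ⊔ J) := by rw [hBJ]; exact sup_le_sup le_rfl hIF
    _ ≤ C ⊔ F * B ⊔ I * J := by
      rw [Submodule.mul_sup, ← sup_assoc]
      exact sup_le_sup le_rfl (mul_le_mul' inf_le_right le_rfl)

end FiniteCodimension

/-! ### Extension of derivations to the enveloping algebra -/

section Enveloping

open UniversalEnvelopingAlgebra

variable (K : Type*) {A : Type*} [Field K] [LieRing A] [LieAlgebra K A]

theorem adjoin_range_ι : Algebra.adjoin K (Set.range (ι K (L := A))) = ⊤ := by
  let S := Algebra.adjoin K (Set.range (ι K (L := A)))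
  let f : A →ₗ⁅K⁆ S :=
    { toFun x := ⟨ι K x, Algebra.subset_adjoin ⟨x, rfl⟩⟩
      map_add' _ _ := Subtype.ext (map_add _ _ _)
      map_smul' _ _ := Subtype.ext (map_smul _ _ _)
      map_lie' := Subtype.ext (LieHom.map_lie _ _ _) }
  have h : S.val.comp (lift K f) = AlgHom.id K _ := by
    ext x
    simp [f]
  refine eq_top_iff.2 fun u _ => ?_
  have := DFunLike.congr_fun h u
  change ((lift K f u : S) : UniversalEnvelopingAlgebra K A) = u at this
  rw [← this]
  exact (lift K f u).2

variable {K}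

theorem induction_on {p : UniversalEnvelopingAlgebra K A → Prop} (u : UniversalEnvelopingAlgebra K A)
    (hι : ∀ x, p (ι K x)) (hK : ∀ c, p (algebraMap K _ c)) (hadd : ∀ a b, p a → p b → p (a + b))
    (hmul : ∀ a b, p a → p b → p (a * b)) : p u := by
  have hu : u ∈ Algebra.adjoin K (Set.range (ι K (L := A))) := by
    rw [adjoin_range_ι]; trivial
  induction hu using Algebra.adjoin_induction with
  | mem x hx => obtain ⟨x, rfl⟩ := hx; exact hι x
  | algebraMap c => exact hK c
  | add a b _ _ ha hb => exact hadd a b ha hb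
  | mul a b _ _ ha hb => exact hmul a b ha hb

/-- The algebra homomorphism `u ↦ u + ε D u` attached to a derivation of a Lie algebra. -/
noncomputable def derivationHom (δ : LieDerivation K A A) :
    UniversalEnvelopingAlgebra K A →ₐ[K]
      TrivSqZeroExt (UniversalEnvelopingAlgebra K A) (UniversalEnvelopingAlgebra K A) :=
  lift K
    { toFun x := TrivSqZeroExt.inl (ι K x) + TrivSqZeroExt.inr (ι K (δ x))
      map_add' x y := by ext <;> simp
      map_smul' c x := by ext <;> simp
      map_lie' := by
        intro x y
        ext
        · simp [LieRing.of_associative_ring_bracket]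
        · simp only [LieDerivation.apply_lie_eq_add, map_add, LieHom.map_lie,
            LieRing.of_associative_ring_bracket, TrivSqZeroExt.snd_add, TrivSqZeroExt.snd_sub,
            TrivSqZeroExt.snd_mul, TrivSqZeroExt.snd_inl, TrivSqZeroExt.snd_inr,
            TrivSqZeroExt.fst_add, TrivSqZeroExt.fst_inl, TrivSqZeroExt.fst_inr, smul_eq_mul,
            MulOpposite.smul_eq_mul_unop, MulOpposite.unop_op]
          noncomm_ring }

theorem fst_derivationHom (δ : LieDerivation K A A) (u : UniversalEnvelopingAlgebra K A) :
    (derivationHom δ u).fst = u := by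
  have h : (TrivSqZeroExt.fstHom K _ _).comp (derivationHom δ) = AlgHom.id K _ := by
    ext x
    simp [derivationHom]
  exact DFunLike.congr_fun h u

/-- The extension of a derivation of a Lie algebra to its universal enveloping algebra. -/
noncomputable def derivationExt (δ : LieDerivation K A A) :
    Module.End K (UniversalEnvelopingAlgebra K A) :=
  (TrivSqZeroExt.sndHom _ _).restrictScalars K ∘ₗ (derivationHom δ).toLinearMap

theorem derivationExt_ι (δ : LieDerivation K A A) (x : A) :
    derivationExt δ (ι K x) = ι K (δ x) := by
  change (derivationHom δ (ι K x)).snd = _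
  rw [derivationHom, lift_ι_apply]
  simp

theorem derivationExt_mul (δ : LieDerivation K A A) (u w : UniversalEnvelopingAlgebra K A) :
    derivationExt δ (u * w) = derivationExt δ u * w + u * derivationExt δ w := by
  change (derivationHom δ (u * w)).snd = (derivationHom δ u).snd * w + u * (derivationHom δ w).snd
  rw [map_mul, TrivSqZeroExt.snd_mul, fst_derivationHom, fst_derivationHom]
  simp [add_comm]

theorem derivationExt_algebraMap (δ : LieDerivation K A A) (c : K) :
    derivationExt δ (algebraMap K _ c) = 0 := by
  change (derivationHom δ _).snd = 0
  rw [AlgHom.commutes]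
  rfl

theorem eq_of_leibniz {D D' : Module.End K (UniversalEnvelopingAlgebra K A)}
    (hD : ∀ u w, D (u * w) = D u * w + u * D w) (hD' : ∀ u w, D' (u * w) = D' u * w + u * D' w)
    (h : ∀ x, D (ι K x) = D' (ι K x)) : D = D' := by
  have h1 : ∀ {D : Module.End K (UniversalEnvelopingAlgebra K A)},
      (∀ u w, D (u * w) = D u * w + u * D w) → D 1 = 0 := by
    intro D hD
    simpa using hD 1 1
  ext u
  induction u using induction_on with
  | hι x => exact h x
  | hK c => rw [Algebra.algebraMap_eq_smul_one, map_smul, map_smul, h1 hD, h1 hD']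
  | hadd a b ha hb => rw [map_add, map_add, ha, hb]
  | hmul a b ha hb => rw [hD, hD', ha, hb]

/-- The extension of derivations to the enveloping algebra, as a homomorphism of Lie algebras. -/
noncomputable def derivationExtHom :
    LieDerivation K A A →ₗ⁅K⁆ Module.End K (UniversalEnvelopingAlgebra K A) where
  toFun := derivationExt
  map_add' δ δ' := by
    refine eq_of_leibniz (derivationExt_mul _) (fun u w => ?_) fun x => ?_
    · simp only [LinearMap.add_apply, derivationExt_mul]; noncomm_ring
    · simp [derivationExt_ι, -ι_apply]
  map_smul' c δ := by
    refine eq_of_leibniz (derivationExt_mul _) (fun u w => ?_) fun x => ?_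
    · simp only [LinearMap.smul_apply, derivationExt_mul, RingHom.id_apply, smul_add,
        smul_mul_assoc, mul_smul_comm]
    · simp [derivationExt_ι, -ι_apply]
  map_lie' := by
    intro δ δ'
    refine eq_of_leibniz (derivationExt_mul _) (fun u w => ?_) fun x => ?_
    · simp only [LieRing.of_associative_ring_bracket, LinearMap.sub_apply, Module.End.mul_apply,
        derivationExt_mul, map_add]
      noncomm_ring
    · simp [derivationExt_ι, -ι_apply, LieRing.of_associative_ring_bracket]

@[simp]
theorem derivationExtHom_apply (δ : LieDerivation K A A) :
    derivationExtHom δ = derivationExt δ := rfl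

end Enveloping

/-! ### Finite-codimensional ideals of the enveloping algebra stable under derivations -/

section FilteredIdeal

open UniversalEnvelopingAlgebra LieModule

variable {K A V : Type*} [Field K] [LieRing A] [LieAlgebra K A]
  [AddCommGroup V] [Module K V] [LieRingModule A V] [LieModule K A V]

theorem lift_toEnd_mem (N : LieSubmodule K A V) (u : UniversalEnvelopingAlgebra K A) :
    ∀ v ∈ N, lift K (toEnd K A V) u v ∈ N := by
  induction u using induction_on with
  | hι x => intro v hv; rw [lift_ι_apply]; exact N.lie_mem hv
  | hK c =>
    intro v hv
    rw [AlgHom.commutes, Module.algebraMap_end_apply]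
    exact N.smul_mem c hv
  | hadd a b ha hb => intro v hv; rw [map_add]; exact add_mem (ha v hv) (hb v hv)
  | hmul a b ha hb => intro v hv; rw [map_mul]; exact ha _ (hb v hv)

/-- The elements of the enveloping algebra of `A` which shift the filtration of the `A`-module `V`
by the lower central series of the ideal `N`. -/
def shiftIdeal (N : LieIdeal K A) (V : Type*) [AddCommGroup V] [Module K V] [LieRingModule A V]
    [LieModule K A V] : Submodule K (UniversalEnvelopingAlgebra K A) where
  carrier := {u | ∀ i, ∀ v ∈ N.lcs V i, lift K (toEnd K A V) u v ∈ N.lcs V (i + 1)}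
  add_mem' ha hb i v hv := by rw [map_add]; exact add_mem (ha i v hv) (hb i v hv)
  zero_mem' i v _ := by rw [map_zero]; exact zero_mem _
  smul_mem' c u hu i v hv := by
    rw [map_smul]; exact SMulMemClass.smul_mem c (hu i v hv)

variable {N : LieIdeal K A}

theorem mul_mem_shiftIdeal_left {u : UniversalEnvelopingAlgebra K A} (hu : u ∈ shiftIdeal N V)
    (w : UniversalEnvelopingAlgebra K A) : w * u ∈ shiftIdeal N V := by
  intro i v hv
  rw [map_mul]
  exact lift_toEnd_mem _ w _ (hu i v hv)

theorem mul_mem_shiftIdeal_right {u : UniversalEnvelopingAlgebra K A} (hu : u ∈ shiftIdeal N V)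
    (w : UniversalEnvelopingAlgebra K A) : u * w ∈ shiftIdeal N V := by
  intro i v hv
  rw [map_mul]
  exact hu i _ (lift_toEnd_mem _ w _ hv)

theorem ι_mem_shiftIdeal {n : A} (hn : n ∈ N) : ι K n ∈ shiftIdeal N V := by
  intro i v hv
  rw [lift_ι_apply, LieIdeal.lcs_succ]
  exact LieSubmodule.lie_mem_lie hn hv

/-- Generators go into `N`, hence into the two-sided ideal `shiftIdeal N V`; the Leibniz rule
propagates this to products. -/
theorem derivationExt_mem_shiftIdeal {δ : LieDerivation K A A} (hδ : ∀ x, δ x ∈ N)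
    (u : UniversalEnvelopingAlgebra K A) : derivationExt δ u ∈ shiftIdeal N V := by
  induction u using induction_on with
  | hι x => rw [derivationExt_ι]; exact ι_mem_shiftIdeal (hδ x)
  | hK c => rw [derivationExt_algebraMap]; exact zero_mem _
  | hadd a b ha hb => rw [map_add]; exact add_mem ha hb
  | hmul a b ha hb =>
    rw [derivationExt_mul]
    exact add_mem (mul_mem_shiftIdeal_right ha b) (mul_mem_shiftIdeal_left hb a)

theorem shiftIdeal_mul_top : shiftIdeal N V * ⊤ ≤ shiftIdeal N V :=
  Submodule.mul_le.2 fun _ hu w _ => mul_mem_shiftIdeal_right hu w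

/-- The ideal contains the kernel of the map from the enveloping algebra to the finite-dimensional
`End V`. -/
theorem finite_quotient_shiftIdeal [FiniteDimensional K V] :
    Module.Finite K (UniversalEnvelopingAlgebra K A ⧸ shiftIdeal N V) := by
  let φ := (lift K (toEnd K A V)).toLinearMap
  have hle : LinearMap.ker φ ≤ shiftIdeal N V := by
    intro u hu i v _
    have : lift K (toEnd K A V) u = 0 := hu
    rw [this]
    exact zero_mem _
  have : Module.Finite K (UniversalEnvelopingAlgebra K A ⧸ LinearMap.ker φ) :=
    Module.Finite.equiv φ.quotKerEquivRange.symm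
  exact Module.Finite.of_surjective _ (Submodule.factor_surjective hle)

theorem finite_quotient_shiftIdeal_pow [FiniteDimensional K A] [FiniteDimensional K V] (k : ℕ) :
    Module.Finite K (UniversalEnvelopingAlgebra K A ⧸ shiftIdeal N V ^ (k + 1)) := by
  have h1 := finite_quotient_shiftIdeal (N := N) (V := V)
  induction k with
  | zero => rwa [zero_add, pow_one]
  | succ k ih =>
    rw [pow_succ']
    have hfg : (LinearMap.range (ι K (L := A) : A →ₗ[K] UniversalEnvelopingAlgebra K A)).FG :=
      Module.Finite.iff_fg.1 inferInstance
    exact finite_quotient_mul hfg (adjoin_range_ι K) shiftIdeal_mul_top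

theorem lift_mem_of_mem_shiftIdeal_pow {k : ℕ} :
    ∀ {u}, u ∈ shiftIdeal N V ^ k → ∀ i, ∀ v ∈ N.lcs V i,
      lift K (toEnd K A V) u v ∈ N.lcs V (i + k) := by
  induction k with
  | zero =>
    intro u hu i v hv
    rw [pow_zero, Submodule.one_eq_span, Submodule.mem_span_singleton] at hu
    obtain ⟨c, rfl⟩ := hu
    rw [map_smul, map_one]
    exact SMulMemClass.smul_mem c hv
  | succ k ih =>
    intro u hu i v hv
    rw [pow_succ] at hu
    induction hu using Submodule.mul_induction_on' with
    | mem_mul_mem a ha b hb =>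
      rw [map_mul]
      have := ih ha _ _ (hb i v hv)
      rwa [add_assoc, add_comm 1 k] at this
    | add a _ b _ ha hb => rw [map_add]; exact add_mem ha hb

/-- By Engel, the filtration `N.lcs V i` reaches zero, so a high power of the shift ideal kills `V`.
Derivations with values in `N` send the whole algebra into the shift ideal, hence preserve its
powers, and these still have finite codimension. -/
theorem exists_ideal_finite_quotient [FiniteDimensional K A] [FiniteDimensional K V]
    (N : LieIdeal K A) (hN : ∀ n ∈ N, IsNilpotent (toEnd K A V n)) :
    ∃ J : Submodule K (UniversalEnvelopingAlgebra K A),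
      Module.Finite K (UniversalEnvelopingAlgebra K A ⧸ J) ∧
      (∀ w, ∀ u ∈ J, w * u ∈ J) ∧
      (∀ u ∈ J, lift K (toEnd K A V) u = 0) ∧
      (∀ δ : LieDerivation K A A, (∀ x, δ x ∈ N) → ∀ u ∈ J, derivationExt δ u ∈ J) ∧
      ∀ n ∈ N, ∃ k, ∀ u, ι K n ^ k * u ∈ J := by
  have hnil : LieModule.IsNilpotent N V := by
    rw [LieModule.isNilpotent_iff_forall (R := K)]
    exact fun n => hN n n.2
  obtain ⟨k, hk⟩ := (LieModule.isNilpotent_iff K _ _).1 hnil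
  have hk' : N.lcs V k = ⊥ := by
    rw [← LieSubmodule.toSubmodule_inj, LieIdeal.coe_lcs_eq, hk]
    rfl
  -- The exponent must be positive even when `k = 0`: the zeroth power is the line `K · 1`, not an
  -- ideal of finite codimension.
  refine ⟨shiftIdeal N V ^ (k + 1), finite_quotient_shiftIdeal_pow k, ?_, ?_, ?_, ?_⟩
  · intro w u hu
    rw [pow_succ'] at hu ⊢
    have : (⊤ : Submodule K (UniversalEnvelopingAlgebra K A)) * shiftIdeal N V ≤ shiftIdeal N V :=
      Submodule.mul_le.2 fun w _ _ hu => mul_mem_shiftIdeal_left hu w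
    refine mul_le_mul_left this _ ?_
    rw [mul_assoc]
    exact Submodule.mul_mem_mul trivial hu
  · intro u hu
    ext v
    have h := lift_mem_of_mem_shiftIdeal_pow hu 0 v (by simp)
    have h2 : N.lcs V (k + 1) = ⊥ := by
      rw [LieIdeal.lcs_succ, hk', LieSubmodule.lie_bot]
    rw [zero_add, h2] at h
    exact h
  · intro δ hδ u hu
    clear hk hk'
    induction k generalizing u with
    | zero =>
      rw [zero_add, pow_one]
      exact derivationExt_mem_shiftIdeal hδ u
    | succ k ih =>
      rw [pow_succ] at hu ⊢
      induction hu using Submodule.mul_induction_on' with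
      | mem_mul_mem a ha b hb =>
        rw [derivationExt_mul]
        exact add_mem (Submodule.mul_mem_mul (ih a ha) hb)
          (Submodule.mul_mem_mul ha (derivationExt_mem_shiftIdeal hδ b))
      | add a _ b _ ha hb => rw [map_add]; exact add_mem ha hb
  · intro n hn
    refine ⟨k + 1, fun u => ?_⟩
    rw [pow_succ, pow_succ, mul_assoc]
    exact Submodule.mul_mem_mul (Submodule.pow_mem_pow _ (ι_mem_shiftIdeal hn) k)
      (mul_mem_shiftIdeal_right (ι_mem_shiftIdeal hn) u)

/-- In the Leibniz expansion of `D ^ n (u * w)` each term has at least `k` derivatives on `u` or at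
least `l` on `w`, because `k + l ≤ n + 1`. The induction avoids the binomial formula. -/
theorem derivation_pow_mul_eq_zero {U : Type*} [Ring U] [Algebra K U] {D : Module.End K U}
    (hD : ∀ u w, D (u * w) = D u * w + u * D w) (n : ℕ) :
    ∀ (k l : ℕ) (u w : U), k + l ≤ n + 1 → (D ^ k) u = 0 → (D ^ l) w = 0 →
      (D ^ n) (u * w) = 0 := by
  have h0 : ∀ (k : ℕ) (u : U), (D ^ k) u = 0 → u = 0 ∨ ∃ j, k = j + 1 ∧ (D ^ j) (D u) = 0 := by
    intro k u h
    cases k with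
    | zero => exact Or.inl h
    | succ j => exact Or.inr ⟨j, rfl, by rwa [pow_succ, Module.End.mul_apply] at h⟩
  induction n with
  | zero =>
    intro k l u w hkl hu hw
    rcases h0 k u hu with rfl | ⟨i, rfl, hi⟩
    · simp
    rcases h0 l w hw with rfl | ⟨j, rfl, hj⟩
    · simp
    omega
  | succ n ih =>
    intro k l u w hkl hu hw
    rcases h0 k u hu with rfl | ⟨i, rfl, hi⟩
    · simp
    rcases h0 l w hw with rfl | ⟨j, rfl, hj⟩
    · simp
    rw [pow_succ, Module.End.mul_apply, hD, map_add, ih i (j + 1) _ _ (by omega) hi hw,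
      ih (i + 1) j _ _ (by omega) hu hj, add_zero]

theorem exists_derivationExt_pow_eq_zero {δ : LieDerivation K A A}
    (hδ : IsNilpotent (δ : A →ₗ[K] A)) (u : UniversalEnvelopingAlgebra K A) :
    ∃ k, (derivationExt δ ^ k) u = 0 := by
  induction u using induction_on with
  | hι x =>
    obtain ⟨k, hk⟩ := hδ
    have key : ∀ j : ℕ, (derivationExt δ ^ j) (ι K x) = ι K (((δ : A →ₗ[K] A) ^ j) x) := by
      intro j
      induction j with
      | zero => rfl
      | succ j ih =>
        rw [pow_succ', pow_succ', Module.End.mul_apply, Module.End.mul_apply, ih, derivationExt_ι]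
        rfl
    exact ⟨k, by rw [key, hk, LinearMap.zero_apply, map_zero]⟩
  | hK c => exact ⟨1, by rw [pow_one, derivationExt_algebraMap]⟩
  | hadd a b ha hb =>
    obtain ⟨k, hk⟩ := ha
    obtain ⟨l, hl⟩ := hb
    refine ⟨k + l, ?_⟩
    rw [map_add, pow_add, Module.End.mul_apply, Module.End.mul_apply, hl, map_zero, add_zero,
      ← Module.End.mul_apply, ← pow_add, add_comm, pow_add, Module.End.mul_apply, hk, map_zero]
  | hmul a b ha hb =>
    obtain ⟨k, hk⟩ := ha
    obtain ⟨l, hl⟩ := hb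
    exact ⟨k + l, derivation_pow_mul_eq_zero (derivationExt_mul δ) _ k l a b (by omega) hk hl⟩

end FilteredIdeal

/-! ### Passing to coordinate spaces -/

section FinRep

variable {K L V : Type*} [Field K] [LieRing L] [LieAlgebra K L] [AddCommGroup V] [Module K V]

/-- Choosing a basis puts every representation on some `Fin n → K`, so that constructions through
enveloping algebras stay in one universe during the inductions. -/
theorem exists_fin_representation [FiniteDimensional K V] (ρ : L →ₗ⁅K⁆ Module.End K V) :
    ∃ (n : ℕ) (ρ' : L →ₗ⁅K⁆ Module.End K (Fin n → K)),
      (∀ x, ρ' x = 0 ↔ ρ x = 0) ∧ ∀ x, IsNilpotent (ρ' x) ↔ IsNilpotent (ρ x) := by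
  let e : V ≃ₗ[K] (Fin (Module.finrank K V) → K) := (Module.finBasis K V).equivFun
  refine ⟨_, (LinearEquiv.lieConj e).toLieHom.comp ρ, fun x => ?_, fun x => ?_⟩
  · exact map_eq_zero_iff (LinearEquiv.lieConj e) (LinearEquiv.lieConj e).injective
  · exact IsNilpotent.map_iff (f := e.conjAlgEquiv K) (e.conjAlgEquiv K).injective

end FinRep

/-! ### Zassenhaus extension along a semidirect product -/

section Zassenhaus

open UniversalEnvelopingAlgebra LieModule

variable {K L : Type*} [Field K] [LieRing L] [LieAlgebra K L]

/-- The action of a Lie algebra on an ideal by derivations. -/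
def adIdeal (a : LieIdeal K L) : L →ₗ⁅K⁆ LieDerivation K a a where
  toFun x :=
    { toFun y := ⟨⁅x, (y : L)⁆, lie_mem_right K L a x y y.2⟩
      map_add' y z := Subtype.ext (lie_add x (y : L) z)
      map_smul' c y := Subtype.ext (lie_smul c x (y : L))
      leibniz' y z := Subtype.ext <| by
        change ⁅x, ⁅(y : L), (z : L)⁆⁆ = ⁅(y : L), ⁅x, (z : L)⁆⁆ - ⁅(z : L), ⁅x, (y : L)⁆⁆
        rw [leibniz_lie x (y : L), ← lie_skew ⁅x, (y : L)⁆]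
        abel }
  map_add' x y := LieDerivation.ext fun z => Subtype.ext (add_lie x y (z : L))
  map_smul' c x := LieDerivation.ext fun z => Subtype.ext (smul_lie c x (z : L))
  map_lie' := by
    intro x y
    refine LieDerivation.ext fun z => Subtype.ext ?_
    rw [LieDerivation.lie_apply]
    exact lie_lie x y (z : L)

theorem coe_adIdeal_apply (a : LieIdeal K L) (x : L) (y : a) :
    (adIdeal a x y : L) = ⁅x, (y : L)⁆ := rfl

/-- The action of `L = a ⋊ h` on the enveloping algebra of `a`: the ideal `a` acts by left
multiplication and the subalgebra `h` by derivations. -/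
theorem exists_action_enveloping (a : LieIdeal K L) (h : LieSubalgebra K L)
    (hc : IsCompl a.toSubmodule h.toSubmodule) :
    ∃ ψ : L →ₗ⁅K⁆ Module.End K (UniversalEnvelopingAlgebra K a),
      (∀ (y : a) u, ψ y u = ι K y * u) ∧ ∀ x ∈ h, ψ x = derivationExt (adIdeal a x) := by
  let pa : L →ₗ[K] a := a.toSubmodule.projectionOnto h.toSubmodule hc
  have hpa (y : a) : pa y = y := Submodule.projectionOnto_apply_left hc y
  have hph (x : L) (hx : x ∈ h) : pa x = 0 := by
    rw [← LinearMap.mem_ker, Submodule.ker_projectionOnto]; exact hx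
  let ψ : L →ₗ[K] Module.End K (UniversalEnvelopingAlgebra K a) :=
    (LinearMap.mul K (UniversalEnvelopingAlgebra K a)) ∘ₗ (ι K (L := a) : a →ₗ[K] UniversalEnvelopingAlgebra K a) ∘ₗ pa
      + (derivationExtHom.comp (adIdeal a) : L →ₗ[K] _) ∘ₗ
        (LinearMap.id - a.toSubmodule.subtype ∘ₗ pa)
  have hψ (x : L) (u) : ψ x u = ι K (pa x) * u + derivationExt (adIdeal a (x - pa x)) u := rfl
  have ha (y : a) (u) : ψ y u = ι K y * u := by
    rw [hψ, hpa, sub_self, map_zero, ← derivationExtHom_apply, map_zero, LinearMap.zero_apply,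
      add_zero]
  have hh (x : L) (hx : x ∈ h) : ψ x = derivationExt (adIdeal a x) := by
    ext u
    rw [hψ, hph x hx, map_zero, zero_mul, zero_add, ZeroMemClass.coe_zero, sub_zero]
  have haa (y z : a) : ψ ⁅(y : L), (z : L)⁆ = ⁅ψ y, ψ z⁆ := by
    ext u
    have := ha ⁅y, z⁆ u
    change ψ ⁅(y : L), (z : L)⁆ u = _ at this
    rw [this, LieHom.map_lie, LieRing.of_associative_ring_bracket,
      LieRing.of_associative_ring_bracket, LinearMap.sub_apply, Module.End.mul_apply,
      Module.End.mul_apply, ha, ha, ha, ha]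
    noncomm_ring
  have hha (x : L) (hx : x ∈ h) (y : a) : ψ ⁅x, (y : L)⁆ = ⁅ψ x, ψ y⁆ := by
    ext u
    have := ha (adIdeal a x y) u
    rw [coe_adIdeal_apply] at this
    rw [this, LieRing.of_associative_ring_bracket, LinearMap.sub_apply, Module.End.mul_apply,
      Module.End.mul_apply, ha, ha, hh x hx, derivationExt_mul, derivationExt_ι]
    noncomm_ring
  have hhh (x : L) (hx : x ∈ h) (y : L) (hy : y ∈ h) : ψ ⁅x, y⁆ = ⁅ψ x, ψ y⁆ := by
    rw [hh _ (h.lie_mem hx hy), hh x hx, hh y hy, LieHom.map_lie, ← derivationExtHom_apply,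
      LieHom.map_lie]
    rfl
  have hdec (x : L) : ∃ y : a, ∃ z ∈ h, x = y + z := by
    have : x ∈ a.toSubmodule ⊔ h.toSubmodule := by rw [hc.sup_eq_top]; trivial
    obtain ⟨y, hy, z, hz, rfl⟩ := Submodule.mem_sup.1 this
    exact ⟨⟨y, hy⟩, z, hz, rfl⟩
  refine ⟨{ ψ with map_lie' := ?_ }, ha, hh⟩
  intro x x'
  change ψ ⁅x, x'⁆ = ⁅ψ x, ψ x'⁆
  obtain ⟨y, z, hz, rfl⟩ := hdec x
  obtain ⟨y', z', hz', rfl⟩ := hdec x'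
  have hah : ψ ⁅(y : L), z'⁆ = ⁅ψ y, ψ z'⁆ := by
    rw [← lie_skew, map_neg, hha z' hz' y, lie_skew]
  simp only [add_lie, lie_add, map_add, haa, hha z hz, hhh z hz z' hz', hah]

/-- **Zassenhaus extension theorem**, for a semidirect product. -/
theorem exists_extension_representation [FiniteDimensional K L] (a : LieIdeal K L)
    (h : LieSubalgebra K L) (hc : IsCompl a.toSubmodule h.toSubmodule)
    {V : Type*} [AddCommGroup V] [Module K V] [FiniteDimensional K V]
    (ρ₀ : a →ₗ⁅K⁆ Module.End K V) (N : LieIdeal K a) (hN : ∀ y ∈ N, IsNilpotent (ρ₀ y))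
    (hhN : ∀ x ∈ h, ∀ y, adIdeal a x y ∈ N) :
    ∃ (n : ℕ) (ρ : L →ₗ⁅K⁆ Module.End K (Fin n → K)),
      (∀ y : a, ρ y = 0 → ρ₀ y = 0) ∧ (∀ y ∈ N, IsNilpotent (ρ y)) ∧
      ∀ x ∈ h, IsNilpotent (adIdeal a x : a →ₗ[K] a) → IsNilpotent (ρ x) := by
  let : LieRingModule a V := LieRingModule.compLieHom V ρ₀
  have : LieModule K a V := LieModule.compLieHom V ρ₀
  have hρ₀ : toEnd K a V = ρ₀ := by ext; rfl
  obtain ⟨J, hJ1, hJ2, hJ3, hJ4, hJ5⟩ := exists_ideal_finite_quotient (V := V) N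
    (by rwa [hρ₀])
  rw [hρ₀] at hJ3
  obtain ⟨ψ, hψa, hψh⟩ := exists_action_enveloping a h hc
  have hψJ (x : L) : J ≤ J.comap (ψ x) := by
    intro u hu
    have : x ∈ a.toSubmodule ⊔ h.toSubmodule := by rw [hc.sup_eq_top]; trivial
    obtain ⟨y, hy, z, hz, rfl⟩ := Submodule.mem_sup.1 this
    rw [Submodule.mem_comap, map_add, LinearMap.add_apply]
    refine add_mem ?_ ?_
    · rw [hψa ⟨y, hy⟩]; exact hJ2 _ _ hu
    · rw [hψh z hz]; exact hJ4 _ (hhN z hz) u hu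
  let ρ : L →ₗ⁅K⁆ Module.End K (UniversalEnvelopingAlgebra K a ⧸ J) :=
    { toFun x := J.mapQ J (ψ x) (hψJ x)
      map_add' x y := by ext; simp
      map_smul' c x := by ext; simp
      map_lie' := by
        intro x y
        ext
        simp [LieRing.of_associative_ring_bracket] }
  have hρ (x : L) (k : ℕ) (u) : (ρ x ^ k) (J.mkQ u) = J.mkQ ((ψ x ^ k) u) := by
    induction k with
    | zero => rfl
    | succ k ih =>
      rw [pow_succ', pow_succ', Module.End.mul_apply, Module.End.mul_apply, ih]
      rfl
  obtain ⟨n, ρ', h0, hnil⟩ := exists_fin_representation ρ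
  refine ⟨n, ρ', fun y hy => ?_, fun y hy => ?_, fun x hx hnx => ?_⟩
  -- Evaluation at the class of `1` shows `ι K y ∈ J`, and `J` is killed by the lift of `ρ₀`.
  · rw [h0] at hy
    have h1 := hρ y 1 1
    rw [pow_one, pow_one, hy, LinearMap.zero_apply, eq_comm, Submodule.mkQ_apply,
      Submodule.Quotient.mk_eq_zero, hψa, mul_one] at h1
    have := hJ3 _ h1
    rwa [lift_ι_apply] at this
  · rw [hnil]
    obtain ⟨k, hk⟩ := hJ5 y hy
    refine ⟨k, ?_⟩
    ext u
    have h1 : ∀ j : ℕ, (ψ y ^ j) u = ι K y ^ j * u := by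
      intro j
      induction j with
      | zero => simp
      | succ j ih => rw [pow_succ', pow_succ', Module.End.mul_apply, ih, hψa, mul_assoc]
    change (ρ y ^ k) (J.mkQ u) = 0
    rw [hρ, h1, Submodule.mkQ_apply, Submodule.Quotient.mk_eq_zero]
    exact hk u
  -- The extended derivation is locally nilpotent on the enveloping algebra, which is enough on a
  -- finite-dimensional quotient.
  · rw [hnil, Module.End.isNilpotent_iff_of_finite]
    intro w
    obtain ⟨u, rfl⟩ := J.mkQ_surjective w
    obtain ⟨k, hk⟩ := exists_derivationExt_pow_eq_zero hnx u
    exact ⟨k, by rw [hρ, hψh x hx, hk, map_zero]⟩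

end Zassenhaus

/-! ### Ado's theorem on central ideals of solvable algebras -/

section Solvable

open LieModule Module

variable {K : Type*} [Field K]

theorem isNilpotent_of_span_sup_eq_top {L V : Type*} [LieRing L] [LieAlgebra K L]
    [FiniteDimensional K L] [AddCommGroup V] [Module K V] (ρ : L →ₗ⁅K⁆ Module.End K V)
    (b : LieIdeal K L) (x : L) (hbx : K ∙ x ⊔ b.toSubmodule = ⊤) (hx : IsNilpotent (ρ x))
    (hb : ∀ y ∈ b, IsNilpotent (ρ y)) (y : L) : IsNilpotent (ρ y) := by
  let : LieRingModule L V := LieRingModule.compLieHom V ρ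
  have : LieModule K L V := LieModule.compLieHom V ρ
  have hρ : toEnd K L V = ρ := by ext; rfl
  have h1 : LieModule.IsNilpotent b V := by
    rw [LieModule.isNilpotent_iff_forall (R := K)]
    exact fun y => hb y y.2
  have h2 : LieModule.IsNilpotent L V :=
    LieSubmodule.isNilpotentOfIsNilpotentSpanSupEqTop hbx (by rwa [hρ]) h1
  rw [LieModule.isNilpotent_iff_forall (R := K), hρ] at h2
  exact h2 y

theorem isNilpotent_of_forall_coe_eq {L : Type*} [LieRing L] [LieAlgebra K L] (b : LieIdeal K L)
    (x : L) (hx : IsNilpotent (LieAlgebra.ad K L x)) :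
    IsNilpotent (adIdeal b x : b →ₗ[K] b) := by
  obtain ⟨k, hk⟩ := hx
  have key : ∀ (j : ℕ) (y : b), (((adIdeal b x : b →ₗ[K] b) ^ j) y : L)
      = (LieAlgebra.ad K L x ^ j) (y : L) := by
    intro j
    induction j with
    | zero => intro y; rfl
    | succ j ih =>
      intro y
      rw [pow_succ, pow_succ, Module.End.mul_apply, Module.End.mul_apply, ih]
      rfl
  exact ⟨k, LinearMap.ext fun y => Subtype.ext (by rw [key, hk]; rfl)⟩

/-- Let `x` act on `K × L` by `(c, y) ↦ (0, c x)`: all products of two such maps vanish, and `(1,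
0)` recovers `x`. -/
theorem exists_representation_of_isLieAbelian {L : Type*} [LieRing L] [LieAlgebra K L]
    [FiniteDimensional K L] (hL : ∀ x y : L, ⁅x, y⁆ = 0) :
    ∃ (n : ℕ) (ρ : L →ₗ⁅K⁆ Module.End K (Fin n → K)),
      (∀ x, ρ x = 0 → x = 0) ∧ ∀ x, IsNilpotent (ρ x) := by
  let f : L →ₗ[K] Module.End K (K × L) :=
    LinearMap.mk₂ K (fun x w => (0, w.1 • x)) (by simp) (fun c x w => by simp [smul_comm w.1 c x])
      (by simp [add_smul]) (by simp [mul_smul])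
  have hf (x : L) (w : K × L) : f x w = (0, w.1 • x) := rfl
  have hff (x y : L) : f x * f y = 0 := by ext <;> simp [hf]
  let ρ : L →ₗ⁅K⁆ Module.End K (K × L) :=
    { f with
      map_lie' := by
        intro x y
        change f ⁅x, y⁆ = ⁅f x, f y⁆
        rw [LieRing.of_associative_ring_bracket, hff, hff, hL, map_zero, sub_self] }
  obtain ⟨n, ρ', h0, hnil⟩ := exists_fin_representation ρ
  refine ⟨n, ρ', fun x hx => ?_, fun x => ?_⟩
  · rw [h0] at hx
    have : f x (1, 0) = 0 := by
      change ρ x (1, 0) = 0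
      rw [hx, LinearMap.zero_apply]
    simpa [hf] using this
  · rw [hnil]
    exact ⟨2, (pow_two _).trans (hff x x)⟩

/-- A line is a subalgebra, so `L` is the semidirect product of `b` and `K x`, and Zassenhaus
extension applies. -/
theorem exists_extension_of_isCoatom {L : Type*} [LieRing L] [LieAlgebra K L]
    [FiniteDimensional K L] (b : LieIdeal K L) (x : L) (hb : IsCoatom b.toSubmodule) (hx : x ∉ b)
    {m : ℕ} (ρ₀ : b →ₗ⁅K⁆ Module.End K (Fin m → K)) (N : LieIdeal K b)
    (hN : ∀ y ∈ N, IsNilpotent (ρ₀ y)) (hbN : ∀ x y, adIdeal b x y ∈ N) :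
    ∃ (n : ℕ) (ρ : L →ₗ⁅K⁆ Module.End K (Fin n → K)),
      (∀ y : b, ρ y = 0 → ρ₀ y = 0) ∧ (∀ y ∈ N, IsNilpotent (ρ y)) ∧
      (IsNilpotent (LieAlgebra.ad K L x) → IsNilpotent (ρ x)) := by
  let h : LieSubalgebra K L :=
    { K ∙ x with
      lie_mem' := by
        intro y z hy hz
        obtain ⟨c, rfl⟩ := Submodule.mem_span_singleton.1 hy
        obtain ⟨d, rfl⟩ := Submodule.mem_span_singleton.1 hz
        simp }
  have hc : IsCompl b.toSubmodule h.toSubmodule :=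
    Submodule.isCompl_span_singleton_of_isCoatom_of_notMem hb hx
  obtain ⟨n, ρ, h1, h2, h3⟩ := exists_extension_representation b h hc ρ₀ N hN
    fun x _ y => hbN x y
  exact ⟨n, ρ, h1, h2, fun hx => h3 x (Submodule.mem_span_singleton_self x)
    (isNilpotent_of_forall_coe_eq b x hx)⟩

/-- Ado's theorem for the central elements of a solvable Lie algebra. -/
theorem exists_representation_solvable (d : ℕ) :
    ∀ (L : Type v) [LieRing L] [LieAlgebra K L] [FiniteDimensional K L] (N Z : LieIdeal K L),
      finrank K L = d → (∀ y ∈ N, IsNilpotent (LieAlgebra.ad K L y)) → (∀ x y : L, ⁅x, y⁆ ∈ N) →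
      Z ≤ N → (∀ z ∈ Z, ∀ x : L, ⁅x, z⁆ = 0) →
      ∃ (n : ℕ) (ρ : L →ₗ⁅K⁆ Module.End K (Fin n → K)),
        (∀ z ∈ Z, ρ z = 0 → z = 0) ∧ ∀ y ∈ N, IsNilpotent (ρ y) := by
  induction d using Nat.strong_induction_on with
  | _ d ih =>
  intro L _ _ _ N Z hd hN hLN hZN hZ
  -- The inductive step: represent the hyperplane ideal `b` with `N'` acting nilpotently, then
  -- extend to `L`. The condition `⁅L, b⁆ ⊆ N'` makes the derivations of `b` take values in `N'`.
  have step : ∀ b N' : LieIdeal K L, IsCoatom b.toSubmodule → N' ≤ b → N' ≤ N → Z ≤ N' →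
      (∀ x : L, ∀ y ∈ b, ⁅x, y⁆ ∈ N') →
      ∃ (x : L) (n : ℕ) (ρ : L →ₗ⁅K⁆ Module.End K (Fin n → K)),
        K ∙ x ⊔ b.toSubmodule = ⊤ ∧
        (∀ z ∈ Z, ρ z = 0 → z = 0) ∧ (∀ y ∈ N', IsNilpotent (ρ y)) ∧
        (IsNilpotent (LieAlgebra.ad K L x) → IsNilpotent (ρ x)) := by
    intro b N' hb hN'b hN'N hZN' hbN'
    obtain ⟨x, -, hx⟩ := SetLike.exists_of_lt hb.lt_top
    have hlt : finrank K b < d := by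
      rw [← hd]
      exact Submodule.finrank_lt hb.1
    obtain ⟨m, ρ₀, h1, h2⟩ := ih _ hlt b (N'.comap b.incl) (Z.comap b.incl) rfl
      (fun y hy => isNilpotent_of_forall_coe_eq b (y : L) (hN y (hN'N hy)))
      (fun y z => hbN' (y : L) z z.2) (fun z hz => hZN' hz)
      (fun z hz y => Subtype.ext (hZ z hz y))
    obtain ⟨n, ρ, h3, h4, h5⟩ := exists_extension_of_isCoatom b x hb hx ρ₀ (N'.comap b.incl) h2
      (fun y z => hbN' y z z.2)
    refine ⟨x, n, ρ, ?_, fun z hz h => ?_, fun y hy => h4 ⟨y, hN'b hy⟩ hy, h5⟩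
    · rw [sup_comm]
      exact (Submodule.isCompl_span_singleton_of_isCoatom_of_notMem hb hx).sup_eq_top
    · exact congrArg Subtype.val (h1 ⟨z, hN'b (hZN' hz)⟩ hz (h3 ⟨z, hN'b (hZN' hz)⟩ h))
  by_cases hNtop : N = ⊤
  · subst hNtop
    have : LieModule.IsNilpotent (⊤ : LieIdeal K L) L := by
      rw [LieModule.isNilpotent_iff_forall (R := K)]
      exact fun y => hN y y.2
    -- Here `L` is nilpotent. If `[L, L] + Z = L`, iterating gives `L = Z`, which is abelian.
    -- Otherwise some hyperplane contains `[L, L] + Z`; both it and the complementary `x` act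
    -- nilpotently, and Engel covers all of `L`.
    by_cases hP : ⁅(⊤ : LieIdeal K L), (⊤ : LieIdeal K L)⁆ ⊔ Z = ⊤
    · obtain ⟨k, hk⟩ := (LieModule.isNilpotent_iff K _ _).1 this
      have hk' : (⊤ : LieIdeal K L).lcs L k = ⊥ := by
        rw [← LieSubmodule.toSubmodule_inj, LieIdeal.coe_lcs_eq, hk]
        rfl
      have := le_lcs_of_le_lie (⊤ : LieIdeal K L) ⊤ Z hP.ge k
      rw [hk', bot_sup_eq] at this
      obtain ⟨n, ρ, h1, h2⟩ := exists_representation_of_isLieAbelian (K := K) (L := L)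
        fun x y => hZ y (this trivial) x
      exact ⟨n, ρ, fun z _ => h1 z, fun y _ => h2 y⟩
    · have hP' : (⁅(⊤ : LieIdeal K L), (⊤ : LieIdeal K L)⁆ ⊔ Z).toSubmodule ≠ ⊤ := by
        rwa [Ne, LieSubmodule.toSubmodule_eq_top]
      obtain ⟨b, hb, hPb⟩ := (eq_top_or_exists_le_coatom _).resolve_left hP'
      have hbl (x y : L) : ⁅x, y⁆ ∈ b :=
        hPb (LieSubmodule.mem_sup _ _ _ |>.2 ⟨_, LieSubmodule.lie_mem_lie trivial trivial, 0,
          zero_mem _, add_zero _⟩)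
      lift b to LieIdeal K L using fun _ => hbl _ _
      obtain ⟨x, n, ρ, hx, h1, h2, h3⟩ := step b b hb le_rfl le_top
        (le_sup_right.trans ((LieSubmodule.toSubmodule_le_toSubmodule _ _).1 hPb))
        (fun x y _ => hbl x y)
      exact ⟨n, ρ, h1, fun y _ => isNilpotent_of_span_sup_eq_top ρ b x hx (h3 (hN x trivial)) h2 y⟩
  -- Any hyperplane containing `N` contains `[L, L]`, so it is an ideal; nilpotency is needed only
  -- on `N`, and nothing is asked of `x`.
  · have hN' : N.toSubmodule ≠ ⊤ := by rwa [Ne, LieSubmodule.toSubmodule_eq_top]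
    obtain ⟨b, hb, hNb⟩ := (eq_top_or_exists_le_coatom _).resolve_left hN'
    lift b to LieIdeal K L using fun _ => hNb (hLN _ _)
    obtain ⟨-, n, ρ, -, h1, h2, -⟩ := step b N hb
      ((LieSubmodule.toSubmodule_le_toSubmodule _ _).1 hNb) le_rfl hZN (fun x y _ => hLN x y)
    exact ⟨n, ρ, h1, h2⟩

end Solvable

/-! ### Casimir operators and the first Whitehead lemma -/

section Casimir

open LieModule Module

variable {K L M : Type*} [Field K] [LieRing L] [LieAlgebra K L] [FiniteDimensional K L]
  [AddCommGroup M] [Module K M] [LieRingModule L M] [LieModule K L M]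

/-- For dual bases `b i`, `d i` of the trace form take `C = ∑ φ (b i) φ (d i)`. Invariance of the
form makes it commute with `L`, and each summand has trace `1`. -/
theorem exists_casimir (hB : (traceForm K L M).Nondegenerate) :
    ∃ C : Module.End K M, (∀ x : L, Commute (toEnd K L M x) C) ∧
      LinearMap.trace K M C = (finrank K L : K) ∧
      ∀ W : Submodule K M, (∀ (x : L) (m : M), ⁅x, m⁆ ∈ W) → ∀ m, C m ∈ W := by
  classical
  let b := finBasis K L
  let d := LinearMap.BilinForm.dualBasis (traceForm K L M) hB b
  let φ := toEnd K L M
  have hsym : LinearMap.BilinForm.IsSymm (traceForm K L M) := ⟨traceForm_comm K L M⟩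
  have hd (x : L) : x = ∑ i, traceForm K L M x (b i) • d i := by
    conv_lhs => rw [← d.sum_repr x]
    refine Finset.sum_congr rfl fun i _ => ?_
    rw [LinearMap.BilinForm.dualBasis_repr_apply]
  have hb (x : L) : x = ∑ i, traceForm K L M x (d i) • b i := by
    have h1 : LinearMap.BilinForm.dualBasis (traceForm K L M) hB d = b :=
      LinearMap.BilinForm.dualBasis_dualBasis hB hsym b
    conv_lhs => rw [← b.sum_repr x]
    refine Finset.sum_congr rfl fun i _ => ?_
    conv_lhs => rw [← h1]
    rw [LinearMap.BilinForm.dualBasis_repr_apply, h1]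
  refine ⟨∑ i, φ (b i) * φ (d i), fun x => ?_, ?_, fun W hW m => ?_⟩
  · have hinv (i j) : traceForm K L M ⁅x, d i⁆ (b j) = - traceForm K L M ⁅x, b j⁆ (d i) := by
      rw [← lie_skew, map_neg, LinearMap.neg_apply, traceForm_apply_lie_apply, traceForm_comm]
    have h1 (i) : φ ⁅x, b i⁆ * φ (d i)
        = ∑ j, traceForm K L M ⁅x, b i⁆ (d j) • (φ (b j) * φ (d i)) := by
      conv_lhs => rw [hb ⁅x, b i⁆]
      simp only [map_sum, map_smul, Finset.sum_mul, smul_mul_assoc]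
    have h2 (i) : φ (b i) * φ ⁅x, d i⁆
        = - ∑ j, traceForm K L M ⁅x, b j⁆ (d i) • (φ (b i) * φ (d j)) := by
      conv_lhs => rw [hd ⁅x, d i⁆]
      simp only [map_sum, map_smul, Finset.mul_sum, mul_smul_comm, hinv, neg_smul,
        Finset.sum_neg_distrib, map_neg, mul_neg]
    have h3 : ∑ i, (φ ⁅x, b i⁆ * φ (d i) + φ (b i) * φ ⁅x, d i⁆) = 0 := by
      rw [Finset.sum_add_distrib, Finset.sum_congr rfl fun i _ => h1 i,
        Finset.sum_congr rfl fun i _ => h2 i, Finset.sum_neg_distrib, Finset.sum_comm,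
        add_neg_cancel]
    rw [commute_iff_eq, ← sub_eq_zero, ← h3, Finset.mul_sum, Finset.sum_mul,
      ← Finset.sum_sub_distrib]
    refine Finset.sum_congr rfl fun i _ => ?_
    rw [LieHom.map_lie, LieHom.map_lie, LieRing.of_associative_ring_bracket,
      LieRing.of_associative_ring_bracket]
    noncomm_ring
  · rw [map_sum]
    have (i : Fin (finrank K L)) : LinearMap.trace K M (φ (b i) * φ (d i)) = 1 := by
      have := LinearMap.BilinForm.apply_dualBasis_right hB hsym b i i
      rw [if_pos rfl] at this
      exact this
    simp [this]
  · rw [LinearMap.sum_apply]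
    exact sum_mem fun i _ => hW _ _

omit [FiniteDimensional K L] in
-- A form of Cartan's criterion: the derived ideal acts nilpotently on `M`, and faithfulness turns
-- this into nilpotency of the derived ideal itself.
theorem isSolvable_of_traceForm_eq_zero [CharZero K] [FiniteDimensional K M]
    (h : traceForm K L M = 0) (hf : ∀ x : L, toEnd K L M x = 0 → x = 0) :
    LieAlgebra.IsSolvable L := by
  let D := LieAlgebra.derivedSeries K L 1
  have h1 : LieModule.IsNilpotent D M := isNilpotent_derivedSeries_of_traceForm_eq_zero h
  let f : D →ₗ⁅K⁆ Module.End K M := toEnd K D M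
  have hinj : Function.Injective f := by
    rw [injective_iff_map_eq_zero]
    exact fun x hx => Subtype.ext (hf x hx)
  have h2 : LieRing.IsNilpotent f.range := by
    rw [LieAlgebra.isNilpotent_iff_forall (R := K)]
    rintro ⟨_, x, rfl⟩
    refine LieAlgebra.isNilpotent_ad_of_isNilpotent ?_
    exact isNilpotent_toEnd_of_isNilpotent K D M x
  have h3 : LieRing.IsNilpotent D :=
    Function.Injective.lieAlgebra_isNilpotent (R := K) (f := f.rangeRestrict)
      (fun x y hxy => hinj (congrArg Subtype.val hxy))
  obtain ⟨k, hk⟩ := LieAlgebra.IsSolvable.solvable K D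
  refine LieAlgebra.IsSolvable.mk (R := K) (k := k + 1) ?_
  rw [LieIdeal.derivedSeries_eq_bot_iff] at hk
  rw [LieAlgebra.derivedSeries_def, LieAlgebra.derivedSeriesOfIdeal_add]
  exact hk

/-- `S` is the Killing complement of the kernel of the action. It acts faithfully, so by Cartan's
criterion the radical of its trace form is a solvable ideal of `L`, hence zero. -/
theorem exists_ideal_traceForm_nondegenerate [CharZero K] [FiniteDimensional K M]
    [LieAlgebra.HasTrivialRadical K L] :
    ∃ S : LieIdeal K L, (traceForm K S M).Nondegenerate ∧
      ∀ x : L, ∃ s ∈ S, toEnd K L M x = toEnd K L M s := by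
  let q : LieIdeal K L := (toEnd K L M).ker
  let S := q.killingCompl
  have hqS : IsCompl q S := LieIdeal.isCompl_killingCompl q
  have hdec (x : L) : ∃ s ∈ S, toEnd K L M x = toEnd K L M s := by
    have : x ∈ q ⊔ S := by rw [hqS.sup_eq_top]; trivial
    obtain ⟨y, hy, s, hs, rfl⟩ := (LieSubmodule.mem_sup _ _ _).1 this
    refine ⟨s, hs, ?_⟩
    have : toEnd K L M y = 0 := hy
    rw [map_add, this, zero_add]
  refine ⟨S, ?_, hdec⟩
  let k : LieIdeal K L :=
    { carrier := {x | x ∈ S ∧ ∀ y, traceForm K L M x y = 0}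
      add_mem' := fun ha hb => ⟨add_mem ha.1 hb.1, fun y => by
        rw [map_add, LinearMap.add_apply, ha.2, hb.2, add_zero]⟩
      zero_mem' := ⟨zero_mem _, fun y => by rw [map_zero, LinearMap.zero_apply]⟩
      smul_mem' := fun c x hx => ⟨SMulMemClass.smul_mem c hx.1, fun y => by
        rw [map_smul, LinearMap.smul_apply, hx.2, smul_zero]⟩
      lie_mem := fun {x m} hm => ⟨lie_mem_right K L S x m hm.1, fun y => by
        rw [← lie_skew, map_neg, LinearMap.neg_apply, traceForm_apply_lie_apply, hm.2, neg_zero]⟩ }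
  have hk : LieAlgebra.IsSolvable k := by
    refine isSolvable_of_traceForm_eq_zero (K := K) (M := M) ?_ ?_
    · ext x y
      exact x.2.2 y
    · intro x hx
      have h1 : (x : L) ∈ q ⊓ S := ⟨hx, x.2.1⟩
      rw [hqS.inf_eq_bot] at h1
      exact Subtype.ext h1
  have hkbot : k = ⊥ := LieAlgebra.HasTrivialRadical.eq_bot_of_isSolvable k
  refine (traceForm_isSymm K S M).isRefl.nondegenerate_iff_separatingLeft.2 ?_
  intro x hx
  have hxk : (x : L) ∈ k := by
    refine ⟨x.2, fun y => ?_⟩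
    obtain ⟨s, hs, hys⟩ := hdec y
    rw [traceForm_apply_apply, hys]
    exact hx ⟨s, hs⟩
  rw [hkbot] at hxk
  exact Subtype.ext hxk

/-- A form of the first Whitehead lemma: if a semisimple Lie algebra maps `M` to a proper subspace,
then it has an invariant vector outside of it. -/
theorem exists_invariant_notMem [CharZero K] [LieAlgebra.HasTrivialRadical K L] (n : ℕ) :
    ∀ (M : Type v) [AddCommGroup M] [Module K M] [LieRingModule L M] [LieModule K L M]
      [FiniteDimensional K M] (W : Submodule K M), finrank K M = n → W ≠ ⊤ →
      (∀ (x : L) (m : M), ⁅x, m⁆ ∈ W) → ∃ m ∉ W, ∀ x : L, ⁅x, m⁆ = 0 := by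
  induction n using Nat.strong_induction_on with
  | _ n ih =>
  intro M _ _ _ _ _ W hn hW hLW
  obtain ⟨S, hS, hLS⟩ := exists_ideal_traceForm_nondegenerate (K := K) (L := L) (M := M)
  obtain ⟨C, hC, htr, hCW⟩ := exists_casimir hS
  rcases Nat.eq_zero_or_pos (finrank K S) with h0 | hpos
  · obtain ⟨m, -, hm⟩ := SetLike.exists_of_lt (lt_top_iff_ne_top.2 hW)
    refine ⟨m, hm, fun x => ?_⟩
    have : Subsingleton S := finrank_zero_iff.1 h0
    obtain ⟨s, hs, hxs⟩ := hLS x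
    have hs0 : s = 0 := congrArg Subtype.val (Subsingleton.elim (⟨s, hs⟩ : S) 0)
    rw [hs0, map_zero] at hxs
    exact DFunLike.congr_fun hxs m
  · have hCL (x : L) : Commute (toEnd K L M x) C := by
      obtain ⟨s, hs, hxs⟩ := hLS x
      rw [hxs]
      exact hC ⟨s, hs⟩
    -- Fitting decomposition of the Casimir operator. Its image part lies in `W` (this needs `k ≥
    -- 1`), so the kernel part does not; the kernel part is proper because `tr C = dim S ≠ 0`.
    -- Induction applies to it.
    obtain ⟨k, hk, hkpos⟩ := ((LinearMap.eventually_isCompl_ker_pow_range_pow C).and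
      (Filter.eventually_ge_atTop 1)).exists
    let P : LieSubmodule K L M :=
      { LinearMap.ker (C ^ k) with
        lie_mem := by
          intro x m hm
          have hm : (C ^ k) m = 0 := hm
          change (C ^ k) ⁅x, m⁆ = 0
          have := DFunLike.congr_fun ((hCL x).pow_right k).eq m
          rw [Module.End.mul_apply, Module.End.mul_apply, hm, map_zero] at this
          exact this.symm }
    have hrange : LinearMap.range (C ^ k) ≤ W := by
      rintro _ ⟨m, rfl⟩
      obtain ⟨j, rfl⟩ := Nat.exists_eq_add_of_le' hkpos
      rw [pow_succ', Module.End.mul_apply]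
      exact hCW W (fun x m => hLW x m) _
    have hPW : W.comap P.toSubmodule.subtype ≠ ⊤ := by
      intro h
      rw [Submodule.comap_subtype_eq_top] at h
      refine hW (eq_top_iff.2 ?_)
      rw [← hk.sup_eq_top]
      exact sup_le h hrange
    have hPtop : P.toSubmodule ≠ ⊤ := by
      intro h
      have hCk : C ^ k = 0 := LinearMap.ker_eq_top.1 h
      have := (LinearMap.isNilpotent_trace_of_isNilpotent ⟨k, hCk⟩).eq_zero
      rw [htr] at this
      exact hpos.ne' (by exact_mod_cast this)
    have hlt : finrank K P < n := by
      rw [← hn]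
      exact Submodule.finrank_lt hPtop
    obtain ⟨m, hmW, hm⟩ := ih _ hlt P (W.comap P.toSubmodule.subtype) rfl hPW
      fun x m => hLW x m
    exact ⟨m, hmW, fun x => congrArg Subtype.val (hm x)⟩

end Casimir

/-! ### Levi's theorem -/

section Levi

open LieModule Module

variable {K : Type*} [Field K]

theorem exists_lift_of_surjective {L P Q : Type*} [LieRing L] [LieAlgebra K L] [LieRing P]
    [LieAlgebra K P] [LieRing Q] [LieAlgebra K Q] (π : L →ₗ⁅K⁆ Q) (hπ : Function.Surjective π)
    (f : L →ₗ⁅K⁆ P) (hf : ∀ x, π x = 0 → f x = 0) :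
    ∃ g : Q →ₗ⁅K⁆ P, ∀ x, g (π x) = f x := by
  obtain ⟨s, hs⟩ := (π : L →ₗ[K] Q).exists_rightInverse_of_surjective
    (LinearMap.range_eq_top.2 hπ)
  have hs' (q : Q) : π (s q) = q := DFunLike.congr_fun hs q
  have key (x : L) : f (s (π x)) = f x := by
    rw [← sub_eq_zero, ← map_sub]
    exact hf _ (by rw [map_sub, hs', sub_self])
  refine ⟨{ (f : L →ₗ[K] P) ∘ₗ s with map_lie' := ?_ }, key⟩
  intro p q
  obtain ⟨x, rfl⟩ := hπ p
  obtain ⟨y, rfl⟩ := hπ q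
  change f (s ⁅π x, π y⁆) = ⁅f (s (π x)), f (s (π y))⁆
  rw [← LieHom.map_lie, key, key, key, LieHom.map_lie]

variable [CharZero K] {L : Type v} [LieRing L] [LieAlgebra K L] [FiniteDimensional K L]
  {Q : Type*} [LieRing Q] [LieAlgebra K Q] [FiniteDimensional K Q] [LieAlgebra.HasTrivialRadical K Q]

/-- Let `E` be the maps into the kernel that are scalar on it, and `F` the maps `ad m` for `m` in
the kernel. The kernel acts trivially on `E / F`, so `Q` acts there and sends it into the image of
the maps vanishing on the kernel. An invariant class outside that image, rescaled, is a projection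
commuting with each `ad x` up to some `ad m`. -/
theorem exists_projection_of_ker_isLieAbelian (π : L →ₗ⁅K⁆ Q) (hπ : Function.Surjective π)
    (hab : ∀ x y : L, π x = 0 → π y = 0 → ⁅x, y⁆ = 0) :
    ∃ φ : Module.End K L, (∀ x, π (φ x) = 0) ∧ (∀ x, π x = 0 → φ x = x) ∧
      ∀ x : L, ∃ m, π m = 0 ∧ ∀ y : L, ⁅x, φ y⁆ - φ ⁅x, y⁆ = ⁅m, y⁆ := by
  by_cases hker : ∀ x, π x = 0 → x = 0
  · exact ⟨0, fun x => by simp, fun x hx => by simp [hker x hx],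
      fun x => ⟨0, by simp, fun y => by simp⟩⟩
  -- `E` consists of the maps into the kernel of `π` which are scalar on it
  let E : LieSubmodule K L (Module.End K L) :=
    { carrier := {φ | (∀ x, π (φ x) = 0) ∧ ∃ c : K, ∀ x, π x = 0 → φ x = c • x}
      add_mem' := by
        rintro φ ψ ⟨h1, c, hc⟩ ⟨h2, d, hd⟩
        exact ⟨fun x => by rw [LinearMap.add_apply, map_add, h1, h2, add_zero], c + d,
          fun x hx => by rw [LinearMap.add_apply, hc x hx, hd x hx, add_smul]⟩
      zero_mem' := ⟨fun x => by simp, 0, fun x _ => by simp⟩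
      smul_mem' := by
        rintro a φ ⟨h1, c, hc⟩
        exact ⟨fun x => by rw [LinearMap.smul_apply, map_smul, h1, smul_zero], a * c,
          fun x hx => by rw [LinearMap.smul_apply, hc x hx, mul_smul]⟩
      lie_mem := by
        rintro x φ ⟨h1, c, hc⟩
        refine ⟨fun y => ?_, 0, fun y hy => ?_⟩
        · rw [LieHom.lie_apply, map_sub, LieHom.map_lie, h1, h1, lie_zero, sub_zero]
        · rw [LieHom.lie_apply, hc y hy, hc ⁅x, y⁆ (by rw [LieHom.map_lie, hy, lie_zero]),
            lie_smul, sub_self, zero_smul] }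
  let F : LieSubmodule K L E :=
    { carrier := {φ | ∃ m, π m = 0 ∧ ∀ y, (φ : Module.End K L) y = ⁅m, y⁆}
      add_mem' := by
        rintro φ ψ ⟨m, hm, h1⟩ ⟨n, hn, h2⟩
        refine ⟨m + n, by rw [map_add, hm, hn, add_zero], fun y => ?_⟩
        rw [add_lie, ← h1, ← h2]
        rfl
      zero_mem' := ⟨0, by simp, fun y => by simp⟩
      smul_mem' := by
        rintro a φ ⟨m, hm, h1⟩
        refine ⟨a • m, by rw [map_smul, hm, smul_zero], fun y => ?_⟩
        rw [smul_lie, ← h1]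
        rfl
      lie_mem := by
        rintro x φ ⟨m, hm, h1⟩
        refine ⟨⁅x, m⁆, by rw [LieHom.map_lie, hm, lie_zero], fun y => ?_⟩
        rw [LieSubmodule.coe_bracket, LieHom.lie_apply, h1, h1, lie_lie] }
  have htriv (x : L) (hx : π x = 0) : toEnd K L (E ⧸ F) x = 0 := by
    ext φ
    obtain ⟨φ, rfl⟩ := LieSubmodule.Quotient.surjective_mk' F φ
    rw [toEnd_apply_apply, ← LieModuleHom.map_lie, LinearMap.zero_apply,
      LieSubmodule.Quotient.mk_eq_zero]
    obtain ⟨h1, c, hc⟩ := φ.2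
    -- For `x` in the abelian kernel, `⁅x, φ y⁆ = 0` and `φ ⁅x, y⁆ = c ⁅x, y⁆`, so `⁅x, φ⁆ = ad (-c
    -- x)` lies in `F`.
    refine ⟨- c • x, by rw [map_smul, hx, smul_zero], fun y => ?_⟩
    rw [LieSubmodule.coe_bracket, LieHom.lie_apply, hab _ _ hx (h1 y),
      hc ⁅x, y⁆ (by rw [LieHom.map_lie, hx, zero_lie]), smul_lie, neg_smul, zero_sub]
  obtain ⟨ρ, hρ⟩ := exists_lift_of_surjective π hπ (toEnd K L (E ⧸ F)) htriv
  let : LieRingModule Q (E ⧸ F) := LieRingModule.compLieHom (E ⧸ F) ρ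
  have : LieModule K Q (E ⧸ F) := LieModule.compLieHom (E ⧸ F) ρ
  have hact (x : L) (φ : E ⧸ F) : ⁅π x, φ⁆ = ⁅x, φ⁆ := DFunLike.congr_fun (hρ x) φ
  let E₀ : Submodule K E :=
    { carrier := {φ | ∀ x, π x = 0 → (φ : Module.End K L) x = 0}
      add_mem' := fun {φ ψ} h1 h2 x hx => by
        change (φ : Module.End K L) x + (ψ : Module.End K L) x = 0
        rw [h1 x hx, h2 x hx, add_zero]
      zero_mem' := fun x _ => rfl
      smul_mem' := fun a φ h1 x hx => by
        change a • (φ : Module.End K L) x = 0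
        rw [h1 x hx, smul_zero] }
  have hFE₀ : F.toSubmodule ≤ E₀ := by
    rintro φ ⟨m, hm, h1⟩ x hx
    rw [h1, hab _ _ hm hx]
  let mk : E →ₗ[K] E ⧸ F := (LieSubmodule.Quotient.mk' F : E →ₗ[K] E ⧸ F)
  have hmk (φ : E) : mk φ ∈ E₀.map mk ↔ φ ∈ E₀ := by
    refine ⟨?_, Submodule.mem_map_of_mem⟩
    rintro ⟨ψ, hψ, h⟩
    have h1 : φ - ψ ∈ F := by
      rw [← LieSubmodule.Quotient.mk_eq_zero, map_sub, sub_eq_zero]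
      exact h.symm
    have := E₀.add_mem (hFE₀ h1) hψ
    rwa [sub_add_cancel] at this
  have hW : E₀.map mk ≠ ⊤ := by
    intro htop
    push Not at hker
    obtain ⟨x, hx, hx0⟩ := hker
    -- Any linear projection onto the nonzero kernel lies in `E` with scalar `1`, hence outside
    -- `E₀`.
    obtain ⟨p, hp⟩ := (LinearMap.ker (π : L →ₗ[K] Q)).exists_isCompl
    let e := (LinearMap.ker (π : L →ₗ[K] Q)).subtype ∘ₗ Submodule.projectionOnto _ _ hp
    have he (y : L) (hy : π y = 0) : e y = y :=
      congrArg Subtype.val (Submodule.projectionOnto_apply_left hp ⟨y, hy⟩)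
    have heE : e ∈ E :=
      ⟨fun y => (Submodule.projectionOnto _ _ hp y).2, 1, fun y hy => by rw [he y hy, one_smul]⟩
    have := (hmk ⟨e, heE⟩).1 (by rw [htop]; trivial) x hx
    exact hx0 (by rw [← he x hx]; exact this)
  have hLW (q : Q) (φ : E ⧸ F) : ⁅q, φ⁆ ∈ E₀.map mk := by
    obtain ⟨x, rfl⟩ := hπ q
    obtain ⟨φ, rfl⟩ := LieSubmodule.Quotient.surjective_mk' F φ
    rw [hact, ← LieModuleHom.map_lie]
    refine (hmk _).2 fun y hy => ?_
    obtain ⟨h1, c, hc⟩ := φ.2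
    rw [LieSubmodule.coe_bracket, LieHom.lie_apply, hc y hy,
      hc ⁅x, y⁆ (by rw [LieHom.map_lie, hy, lie_zero]), lie_smul, sub_self]
  obtain ⟨φ, hφ, hinv⟩ := exists_invariant_notMem (K := K) (L := Q) _ (E ⧸ F) (E₀.map mk) rfl hW hLW
  obtain ⟨φ, rfl⟩ := LieSubmodule.Quotient.surjective_mk' F φ
  have hφ' : φ ∉ E₀ := fun h => hφ ((hmk φ).2 h)
  obtain ⟨⟨φ, h1, c, hc⟩, rfl⟩ : ∃ ψ : E, ψ = φ := ⟨φ, rfl⟩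
  have hc0 : c ≠ 0 := by
    rintro rfl
    exact hφ' fun x hx => by simpa using hc x hx
  refine ⟨c⁻¹ • φ, fun x => ?_, fun x hx => ?_, fun x => ?_⟩
  · rw [LinearMap.smul_apply, map_smul, h1, smul_zero]
  · rw [LinearMap.smul_apply, hc x hx, smul_smul, inv_mul_cancel₀ hc0, one_smul]
  · have h2 := hinv (π x)
    rw [hact, ← LieModuleHom.map_lie, LieSubmodule.Quotient.mk_eq_zero] at h2
    obtain ⟨m, hm, h3⟩ := h2
    refine ⟨c⁻¹ • m, by rw [map_smul, hm, smul_zero], fun y => ?_⟩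
    rw [smul_lie, ← h3, LieSubmodule.coe_bracket, LieHom.lie_apply, LinearMap.smul_apply,
      LinearMap.smul_apply, lie_smul, smul_sub]

/-- **Levi's theorem** for a central kernel. -/
theorem exists_section_of_ker_central (π : L →ₗ⁅K⁆ Q) (hπ : Function.Surjective π)
    (hz : ∀ x y : L, π x = 0 → ⁅x, y⁆ = 0) : ∃ σ : Q →ₗ⁅K⁆ L, ∀ q, π (σ q) = q := by
  obtain ⟨φ, h1, h2, h3⟩ := exists_projection_of_ker_isLieAbelian π hπ fun x y hx _ => hz x y hx
  have h4 (x y : L) : φ ⁅x, y⁆ = ⁅x, φ y⁆ := by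
    obtain ⟨m, hm, h⟩ := h3 x
    have := h y
    rw [hz m y hm, sub_eq_zero] at this
    exact this.symm
  obtain ⟨s, hs⟩ := (π : L →ₗ[K] Q).exists_rightInverse_of_surjective
    (LinearMap.range_eq_top.2 hπ)
  have hs' (q : Q) : π (s q) = q := DFunLike.congr_fun hs q
  have hπσ (q : Q) : π (s q - φ (s q)) = q := by rw [map_sub, h1, hs', sub_zero]
  have hφσ (q : Q) : φ (s q - φ (s q)) = 0 := by rw [map_sub, h2 _ (h1 _), sub_self]
  -- With a central kernel `φ` commutes with all `ad x`, so its kernel is an ideal complementary to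
  -- `ker π`; this section takes values there.
  refine ⟨{ s - φ ∘ₗ s with map_lie' := ?_ }, hπσ⟩
  intro p q
  change s ⁅p, q⁆ - φ (s ⁅p, q⁆) = ⁅s p - φ (s p), s q - φ (s q)⁆
  rw [← sub_eq_zero, ← h2 (_ - _) (by rw [map_sub, hπσ, LieHom.map_lie, hπσ, hπσ, sub_self]),
    map_sub, hφσ, h4, hφσ, lie_zero, sub_zero]

/-- **Levi's theorem** for an abelian kernel. -/
theorem exists_section_of_ker_isLieAbelian (π : L →ₗ⁅K⁆ Q) (hπ : Function.Surjective π)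
    (hab : ∀ x y : L, π x = 0 → π y = 0 → ⁅x, y⁆ = 0) :
    ∃ σ : Q →ₗ⁅K⁆ L, ∀ q, π (σ q) = q := by
  obtain ⟨φ, h1, h2, h3⟩ := exists_projection_of_ker_isLieAbelian π hπ hab
  -- The elements whose adjoint action commutes with `φ`. Correcting `x` by its `m` shows that `P`
  -- maps onto `Q`, and the kernel of this map is central in `P`, which reduces to the central case.
  let P : LieSubalgebra K L :=
    { carrier := {x | ∀ y : L, φ ⁅x, y⁆ = ⁅x, φ y⁆}
      add_mem' := fun {a b} ha hb y => by rw [add_lie, add_lie, map_add, ha, hb]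
      zero_mem' := fun y => by rw [zero_lie, zero_lie, map_zero]
      smul_mem' := fun c x hx y => by rw [smul_lie, smul_lie, map_smul, hx]
      lie_mem' := fun {a b} ha hb y => by
        rw [lie_lie, lie_lie, map_sub, ha, hb, hb, ha] }
  have hP : Function.Surjective (π.comp P.incl) := by
    intro q
    obtain ⟨x, rfl⟩ := hπ q
    obtain ⟨m, hm, h⟩ := h3 x
    refine ⟨⟨x + m, fun y => ?_⟩, ?_⟩
    · have h5 : φ ⁅m, y⁆ = ⁅m, y⁆ := h2 _ (by rw [LieHom.map_lie, hm, zero_lie])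
      rw [add_lie, add_lie, map_add, h5, hab m (φ y) hm (h1 y), ← h y]
      abel
    · change π (x + m) = π x
      rw [map_add, hm, add_zero]
  obtain ⟨σ, hσ⟩ := exists_section_of_ker_central (π.comp P.incl) hP fun x y hx => by
    have hx' : π x = 0 := hx
    refine Subtype.ext ?_
    change ⁅(x : L), (y : L)⁆ = 0
    have h5 : φ ⁅(x : L), (y : L)⁆ = ⁅(x : L), (y : L)⁆ :=
      h2 _ (by rw [LieHom.map_lie, hx', zero_lie])
    rw [← h5, x.2, hab _ _ hx' (h1 _)]
  exact ⟨P.incl.comp σ, hσ⟩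

/-- **Levi's theorem**: a surjection with solvable kernel onto a semisimple Lie algebra splits. -/
theorem exists_section_of_ker_isSolvable (d : ℕ) :
    ∀ (L : Type v) [LieRing L] [LieAlgebra K L] [FiniteDimensional K L] (π : L →ₗ⁅K⁆ Q),
      finrank K π.ker = d → Function.Surjective π → LieAlgebra.IsSolvable π.ker →
      ∃ σ : Q →ₗ⁅K⁆ L, ∀ q, π (σ q) = q := by
  induction d using Nat.strong_induction_on with
  | _ d ih =>
  intro L _ _ _ π hd hπ hsol
  let R : LieIdeal K L := ⁅π.ker, π.ker⁆
  have hRle : R ≤ π.ker := LieSubmodule.lie_le_right _ _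
  by_cases hR : R = ⊥
  · refine exists_section_of_ker_isLieAbelian π hπ fun x y hx hy => ?_
    have : ⁅x, y⁆ ∈ R := LieSubmodule.lie_mem_lie hx hy
    rwa [hR] at this
  have hRlt : R ≠ π.ker := by
    intro h
    obtain ⟨k, hk⟩ := LieAlgebra.IsSolvable.solvable K π.ker
    rw [LieIdeal.derivedSeries_eq_bot_iff] at hk
    have (j : ℕ) : LieAlgebra.derivedSeriesOfIdeal K L j π.ker = π.ker := by
      induction j with
      | zero => rfl
      | succ j ihj => rw [LieAlgebra.derivedSeriesOfIdeal_succ, ihj]; exact h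
    rw [this] at hk
    exact hR (h.trans hk)
  let mk : L →ₗ⁅K⁆ L ⧸ R :=
    { (LieSubmodule.Quotient.mk' R : L →ₗ[K] L ⧸ R) with
      map_lie' := fun {x y} => LieSubmodule.Quotient.mk_bracket _ x y }
  have hmk : Function.Surjective mk := LieSubmodule.Quotient.surjective_mk' R
  have hmk0 (x : L) : mk x = 0 ↔ x ∈ R := LieSubmodule.Quotient.mk_eq_zero R
  obtain ⟨π', hπ'⟩ := exists_lift_of_surjective mk hmk π fun x hx => hRle ((hmk0 x).1 hx)
  obtain ⟨σ', hσ'⟩ := exists_section_of_ker_isLieAbelian π'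
    (fun q => (hπ q).imp' mk fun x hx => by rw [hπ', hx]) (fun x y hx hy => by
      obtain ⟨x, rfl⟩ := hmk x
      obtain ⟨y, rfl⟩ := hmk y
      rw [hπ'] at hx hy
      rw [← LieHom.map_lie, hmk0]
      exact LieSubmodule.lie_mem_lie hx hy)
  -- The preimage of a section modulo `R = [ker π, ker π]`: it still maps onto `Q`, with kernel
  -- inside `R`, strictly smaller than `ker π` by solvability.
  let P : LieSubalgebra K L := σ'.range.comap mk
  have hPker (x : P) (hx : π x = 0) : (x : L) ∈ R := by
    obtain ⟨q, hq⟩ := x.2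
    have h1 : σ' q = mk x := hq
    have h2 := hσ' q
    rw [h1, hπ', hx] at h2
    rw [← hmk0, ← h1, ← h2, map_zero]
  have hP : Function.Surjective (π.comp P.incl) := by
    intro q
    obtain ⟨x, hx⟩ := hmk (σ' q)
    refine ⟨⟨x, q, hx.symm⟩, ?_⟩
    change π x = q
    rw [← hπ', hx, hσ']
  let i : (π.comp P.incl).ker →ₗ⁅K⁆ π.ker :=
    { toFun x := ⟨x, x.2⟩
      map_add' _ _ := rfl
      map_smul' _ _ := rfl
      map_lie' := rfl }
  have hi : Function.Injective i := fun x y h =>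
    Subtype.ext (Subtype.ext (congrArg (fun z : π.ker => (z : L)) h))
  have hlt : finrank K (π.comp P.incl).ker < d := by
    rw [← hd]
    refine lt_of_le_of_lt ?_ (Submodule.finrank_lt_finrank_of_lt (s := R.toSubmodule)
      (t := π.ker.toSubmodule) (lt_of_le_of_ne hRle fun h => hRlt (LieSubmodule.toSubmodule_inj _ _ |>.1 h)))
    let j : (π.comp P.incl).ker →ₗ[K] R :=
      { toFun x := ⟨x, hPker x x.2⟩
        map_add' _ _ := rfl
        map_smul' _ _ := rfl }
    exact LinearMap.finrank_le_finrank_of_injective (f := j) fun x y h =>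
      Subtype.ext (Subtype.ext (congrArg (fun z : R => (z : L)) h))
  obtain ⟨σ, hσ⟩ := ih _ hlt P (π.comp P.incl) rfl hP hi.lieAlgebra_isSolvable
  exact ⟨P.incl.comp σ, hσ⟩

end Levi

/-! ### Ado's theorem with nilpotent action of the nilradical -/

section Ado

open LieModule Module

variable {K : Type*} [Field K] {L : Type v} [LieRing L] [LieAlgebra K L]

/-- The quotient of a Lie algebra by an ideal, as a homomorphism of Lie algebras. -/
def quotientMk (I : LieIdeal K L) : L →ₗ⁅K⁆ L ⧸ I :=
  { (LieSubmodule.Quotient.mk' I : L →ₗ[K] L ⧸ I) with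
    map_lie' := fun {x y} => LieSubmodule.Quotient.mk_bracket _ x y }

theorem quotientMk_eq_zero {I : LieIdeal K L} {x : L} : quotientMk I x = 0 ↔ x ∈ I :=
  LieSubmodule.Quotient.mk_eq_zero I

theorem quotientMk_surjective (I : LieIdeal K L) : Function.Surjective (quotientMk I) :=
  LieSubmodule.Quotient.surjective_mk' I

variable [FiniteDimensional K L]

theorem isNilpotent_ideal_iff_forall (I : LieIdeal K L) :
    LieRing.IsNilpotent I ↔ ∀ x ∈ I, IsNilpotent (LieAlgebra.ad K L x) := by
  have h : LieModule.IsNilpotent I L ↔ ∃ k, I.lcs L k = ⊥ := by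
    rw [LieModule.isNilpotent_iff K]
    refine exists_congr fun k => ?_
    rw [← LieSubmodule.toSubmodule_inj, ← LieSubmodule.toSubmodule_inj, LieIdeal.coe_lcs_eq]
    rfl
  rw [isNilpotent_ideal_iff, ← h, LieModule.isNilpotent_iff_forall (R := K)]
  exact ⟨fun h x hx => h ⟨x, hx⟩, fun h x => h x x.2⟩

theorem isNilpotent_ad_of_mem_nilradical {x : L} (hx : x ∈ nilradical K L) :
    IsNilpotent (LieAlgebra.ad K L x) :=
  (isNilpotent_ideal_iff_forall _).1 (isGreatest_nilradical (K := K) (L := L)).1 x hx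

theorem center_le_nilradical : LieAlgebra.center K L ≤ nilradical K L := by
  refine (isGreatest_nilradical (K := K) (L := L)).2 ((isNilpotent_ideal_iff_forall _).2 ?_)
  intro x hx
  refine ⟨1, LinearMap.ext fun y => ?_⟩
  rw [pow_one, LieAlgebra.ad_apply, ← lie_skew, (LieModule.mem_maxTrivSubmodule K L L x).1 hx y, neg_zero]
  rfl

theorem nilradical_le_radical : nilradical K L ≤ LieAlgebra.radical K L := by
  have h : LieRing.IsNilpotent (nilradical K L) := (isGreatest_nilradical (K := K) (L := L)).1
  rw [← LieAlgebra.LieIdeal.solvable_iff_le_radical]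
  infer_instance

/-- The preimage of a solvable ideal is an extension of solvable by solvable, hence contained in the
radical. -/
theorem hasTrivialRadical_quotient_radical :
    LieAlgebra.HasTrivialRadical K (L ⧸ LieAlgebra.radical K L) := by
  refine LieAlgebra.hasTrivialRadical_of_no_solvable_ideals fun J hJ => ?_
  let π := quotientMk (LieAlgebra.radical K L)
  have hle (k : ℕ) : LieAlgebra.derivedSeriesOfIdeal K L k (J.comap π)
      ≤ (LieAlgebra.derivedSeriesOfIdeal K _ k J).comap π := by
    induction k with
    | zero => exact le_rfl
    | succ k ih =>
      rw [LieAlgebra.derivedSeriesOfIdeal_succ, LieAlgebra.derivedSeriesOfIdeal_succ]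
      exact (LieSubmodule.mono_lie ih ih).trans (LieIdeal.comap_bracket_le π)
  obtain ⟨k, hk⟩ := LieAlgebra.IsSolvable.solvable K J
  obtain ⟨l, hl⟩ := LieAlgebra.IsSolvable.solvable K (LieAlgebra.radical K L)
  rw [LieIdeal.derivedSeries_eq_bot_iff] at hk hl
  have h1 : LieAlgebra.derivedSeriesOfIdeal K L k (J.comap π) ≤ LieAlgebra.radical K L := by
    intro x hx
    have := hle k hx
    rw [hk] at this
    exact quotientMk_eq_zero.1 this
  have h2 : LieAlgebra.IsSolvable (J.comap π) := by
    refine LieAlgebra.IsSolvable.mk (R := K) (k := l + k) ?_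
    rw [LieIdeal.derivedSeries_eq_bot_iff, LieAlgebra.derivedSeriesOfIdeal_add, eq_bot_iff, ← hl]
    exact LieAlgebra.derivedSeriesOfIdeal_mono h1 l
  rw [LieAlgebra.LieIdeal.solvable_iff_le_radical] at h2
  rw [LieSubmodule.eq_bot_iff]
  intro q hq
  obtain ⟨x, rfl⟩ := quotientMk_surjective _ q
  exact quotientMk_eq_zero.2 (h2 hq)

variable [CharZero K]

/-- The solvable case handles the radical `R`, and Zassenhaus extension along a Levi complement
reaches `L`. Both steps rest on `⁅L, R⁆` lying in the nilradical. -/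
theorem exists_representation_injOn_center :
    ∃ (n : ℕ) (ρ : L →ₗ⁅K⁆ Module.End K (Fin n → K)),
      (∀ z ∈ LieAlgebra.center K L, ρ z = 0 → z = 0) ∧
        ∀ x ∈ nilradical K L, IsNilpotent (ρ x) := by
  let R := LieAlgebra.radical K L
  have hRn (x : L) (y : L) (hy : y ∈ R) : ⁅x, y⁆ ∈ nilradical K L :=
    lie_mem_nilradical R (LieSubmodule.lie_mem_lie trivial hy)
  have := hasTrivialRadical_quotient_radical (K := K) (L := L)
  have hker : (quotientMk R).ker = R := by
    ext x; exact quotientMk_eq_zero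
  obtain ⟨σ, hσ⟩ := exists_section_of_ker_isSolvable _ L (quotientMk R) rfl
    (quotientMk_surjective R) (by rw [hker]; infer_instance)
  have hc : IsCompl R.toSubmodule σ.range.toSubmodule := by
    constructor
    · rw [Submodule.disjoint_def]
      rintro _ hx ⟨q, rfl⟩
      have h1 := hσ q
      rw [show quotientMk R (σ q) = 0 from quotientMk_eq_zero.2 hx] at h1
      change σ q = 0
      rw [← h1]
      exact map_zero σ
    · rw [codisjoint_iff, eq_top_iff]
      intro x _
      rw [← sub_add_cancel x (σ (quotientMk R x))]
      refine Submodule.add_mem_sup (quotientMk_eq_zero.1 ?_) ⟨_, rfl⟩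
      rw [map_sub, hσ, sub_self]
  obtain ⟨m, ρ₀, h1, h2⟩ := exists_representation_solvable _ R ((nilradical K L).comap R.incl)
    ((LieAlgebra.center K L).comap R.incl) rfl
    (fun y hy => isNilpotent_of_forall_coe_eq R (y : L) (isNilpotent_ad_of_mem_nilradical hy))
    (fun x y => hRn x y y.2) (fun z hz => center_le_nilradical (K := K) (L := L) hz)
    (fun z hz x => Subtype.ext ((LieModule.mem_maxTrivSubmodule K L L z).1 hz x))
  obtain ⟨n, ρ, h3, h4, -⟩ := exists_extension_representation R σ.range hc ρ₀
    ((nilradical K L).comap R.incl) h2 (fun x _ y => hRn x y y.2)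
  have hle := nilradical_le_radical (K := K) (L := L)
  exact ⟨n, ρ, fun z hz h => congrArg Subtype.val
    (h1 ⟨z, hle (center_le_nilradical hz)⟩ hz (h3 ⟨z, hle (center_le_nilradical hz)⟩ h)),
    fun x hx => h4 ⟨x, hle hx⟩ hx⟩

/-- **Ado's theorem** in characteristic zero: a finite-dimensional Lie algebra has a faithful
finite-dimensional representation in which the nilradical acts nilpotently. -/
theorem exists_faithful_representation :
    ∃ (n : ℕ) (ρ : L →ₗ⁅K⁆ Module.End K (Fin n → K)),
      Function.Injective ρ ∧ ∀ x ∈ nilradical K L, IsNilpotent (ρ x) := by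
  obtain ⟨n, ρ₁, h1, h2⟩ := exists_representation_injOn_center (K := K) (L := L)
  -- The kernel of the adjoint summand is the center, where `ρ₁` is injective.
  let ρ : L →ₗ⁅K⁆ Module.End K ((Fin n → K) × L) :=
    { toFun x := (ρ₁ x).prodMap (LieAlgebra.ad K L x)
      map_add' x y := by rw [map_add, map_add, LinearMap.prodMap_add]
      map_smul' c x := by rw [map_smul, map_smul, LinearMap.prodMap_smul]; rfl
      map_lie' := by
        intro x y
        rw [LieHom.map_lie, LieHom.map_lie]
        simp only [LieRing.of_associative_ring_bracket, LinearMap.prodMap_mul]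
        ext <;> simp }
  have hρ (x : L) : ρ x = (ρ₁ x).prodMap (LieAlgebra.ad K L x) := rfl
  obtain ⟨m, ρ', h3, h4⟩ := exists_fin_representation ρ
  refine ⟨m, ρ', ?_, fun x hx => ?_⟩
  · rw [injective_iff_map_eq_zero]
    intro x hx
    rw [h3, hρ] at hx
    refine h1 x ?_ ?_
    · rw [LieAlgebra.center, LieModule.mem_maxTrivSubmodule]
      intro y
      have := congrArg Prod.snd (DFunLike.congr_fun hx ((0 : Fin n → K), y))
      change ⁅x, y⁆ = 0 at this
      rw [← lie_skew, this, neg_zero]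
    · refine LinearMap.ext fun v => ?_
      exact congrArg Prod.fst (DFunLike.congr_fun hx (v, (0 : L)))
  · rw [h4, hρ]
    obtain ⟨k, hk⟩ := h2 x hx
    obtain ⟨l, hl⟩ := isNilpotent_ad_of_mem_nilradical hx
    refine ⟨k + l, ?_⟩
    have := map_pow (LinearMap.prodMapRingHom K (Fin n → K) L) (ρ₁ x, LieAlgebra.ad K L x) (k + l)
    refine this.symm.trans ?_
    rw [Prod.pow_mk, pow_add, hk, zero_mul, pow_add, hl, mul_zero]
    exact map_zero _

end Ado

/-! ### An integral grading from the primary decomposition of an operator -/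

section IntegralGrading

open Polynomial

variable {K : Type*} [Field K]

theorem nextCoeff_taylor {P : K[X]} (hP : 0 < P.natDegree) (r : K) :
    (taylor r P).nextCoeff = P.nextCoeff + P.natDegree * P.leadingCoeff * r := by
  have h1 : (hasseDeriv (P.natDegree - 1) P).natDegree ≤ 1 := by
    refine (natDegree_hasseDeriv_le P _).trans ?_
    omega
  rw [nextCoeff_of_natDegree_pos (by rwa [natDegree_taylor]), natDegree_taylor, taylor_coeff,
    eval_eq_sum_range' (Nat.lt_succ_of_le h1), nextCoeff_of_natDegree_pos hP]
  obtain ⟨d, hd⟩ := Nat.exists_eq_succ_of_ne_zero hP.ne'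
  rw [leadingCoeff, hd]
  simp [Finset.sum_range_succ, hasseDeriv_coeff, add_comm 1 d]

variable [CharZero K]

/-- An integer-valued function on polynomials of positive degree, compatible with translations. -/
theorem exists_degree_taylor :
    ∃ d : K[X] → ℤ, (∀ P Q, Associated P Q → d P = d Q) ∧
      ∀ (p : ℤ) (P : K[X]), 0 < P.natDegree → d (taylor (p : K) P) = d P - p := by
  obtain ⟨φ, hφ⟩ := (Algebra.linearMap ℚ K).exists_leftInverse_of_injective
    (LinearMap.ker_eq_bot.2 (algebraMap ℚ K).injective)
  have hφp (p : ℤ) : φ (p : K) = p := by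
    have := DFunLike.congr_fun hφ (p : ℚ)
    simpa using this
  -- The argument of `φ` is the mean of the roots of `P`, which lies in `K` and drops by `p` under
  -- `X ↦ X + p`. The `ℚ`-linear retraction `φ : K → ℚ` fixes integers, and the floor commutes with
  -- integer shifts.
  refine ⟨fun P => ⌊φ (-P.nextCoeff / (P.natDegree * P.leadingCoeff))⌋, ?_, fun p P hP => ?_⟩
  · rintro P _ ⟨u, rfl⟩
    obtain ⟨c, hc, hu⟩ := isUnit_iff.1 u.isUnit
    have hc0 : c ≠ 0 := hc.ne_zero
    have h1 : (P * C c).nextCoeff = P.nextCoeff * c := by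
      rw [nextCoeff, nextCoeff, natDegree_mul_C hc0]
      split_ifs <;> simp
    rw [← hu]
    dsimp only
    rw [h1, natDegree_mul_C hc0, leadingCoeff_mul, leadingCoeff_C, ← mul_assoc, ← neg_mul,
      mul_div_mul_right _ _ hc0]
  have h1 : P.leadingCoeff ≠ 0 := by
    rw [leadingCoeff_ne_zero]
    rintro rfl
    simp at hP
  have h2 : (P.natDegree : K) ≠ 0 := by exact_mod_cast hP.ne'
  have h3 : (-(P.nextCoeff + P.natDegree * P.leadingCoeff * p) / (P.natDegree * P.leadingCoeff) : K)
      = -P.nextCoeff / (P.natDegree * P.leadingCoeff) - p := by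
    field_simp
    ring
  dsimp only
  rw [nextCoeff_taylor hP, natDegree_taylor, leadingCoeff_taylor, h3, map_sub, hφp, 
    Int.floor_sub_intCast]

variable {V : Type*} [AddCommGroup V] [Module K V]

/-- The vectors annihilated by a polynomial in `T` all whose irreducible factors have degree
`d` in `S`. -/
def primaryPart (d : K[X] → ℤ) (T : Module.End K V) (S : Set ℤ) : Submodule K V where
  carrier := {v | ∃ M : K[X], M ≠ 0 ∧ (∀ P, Irreducible P → P ∣ M → d P ∈ S) ∧ aeval T M v = 0}
  add_mem' := by
    rintro v w ⟨M, hM, hMS, hv⟩ ⟨N, hN, hNS, hw⟩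
    refine ⟨M * N, mul_ne_zero hM hN, fun P hP hd => ?_, ?_⟩
    · rcases hP.prime.dvd_or_dvd hd with h | h
      exacts [hMS P hP h, hNS P hP h]
    · rw [map_add, map_mul, Module.End.mul_apply, Module.End.mul_apply, hw, map_zero, add_zero,
        ← Module.End.mul_apply, ← map_mul, mul_comm, map_mul, Module.End.mul_apply, hv, map_zero]
  zero_mem' := ⟨1, one_ne_zero, fun P hP h => (hP.not_isUnit (isUnit_of_dvd_one h)).elim,
    map_zero _⟩
  smul_mem' := by
    rintro c v ⟨M, hM, hMS, hv⟩
    exact ⟨M, hM, hMS, by rw [map_smul, hv, smul_zero]⟩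

variable {d : K[X] → ℤ} {T : Module.End K V}

theorem primaryPart_mono {S S' : Set ℤ} (h : S ⊆ S') : primaryPart d T S ≤ primaryPart d T S' := by
  rintro v ⟨M, hM, hMS, hv⟩
  exact ⟨M, hM, fun P hP hd => h (hMS P hP hd), hv⟩

theorem disjoint_primaryPart {S S' : Set ℤ} (h : Disjoint S S') :
    Disjoint (primaryPart d T S) (primaryPart d T S') := by
  rw [Submodule.disjoint_def]
  rintro v ⟨M, hM, hMS, hv⟩ ⟨N, hN, hNS, hw⟩
  have hc : IsCoprime M N := by
    refine isCoprime_of_irreducible_dvd (fun h => hM h.1) fun P hP h1 h2 => ?_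
    exact Set.disjoint_left.1 h (hMS P hP h1) (hNS P hP h2)
  exact Submodule.disjoint_def.1 (disjoint_ker_aeval_of_isCoprime T hc) v hv hw

theorem iSup_primaryPart [FiniteDimensional K V] (hd : ∀ P Q, Associated P Q → d P = d Q) :
    ⨆ q : ℤ, primaryPart d T {q} = ⊤ := by
  have h (M : K[X]) : M ≠ 0 → LinearMap.ker (aeval T M) ≤ ⨆ q : ℤ, primaryPart d T {q} := by
    refine UniqueFactorizationMonoid.induction_on_coprime M ?_ ?_ ?_ ?_
    · exact fun h => (h rfl).elim
    · intro M hM _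
      rw [LinearMap.ker_eq_bot.2]
      · exact bot_le
      · exact ((Module.End.isUnit_iff _).1 (hM.map (aeval T))).1
    · intro P k hP _ v hv
      refine Submodule.mem_iSup_of_mem (d P) ⟨P ^ k, pow_ne_zero _ hP.ne_zero, ?_, hv⟩
      intro Q hQ hQP
      exact hd _ _ (hQ.associated_of_dvd hP.irreducible (hQ.prime.dvd_of_dvd_pow hQP))
    · intro M N hMN h1 h2 hne
      rw [← sup_ker_aeval_eq_ker_aeval_mul_of_coprime T hMN.isCoprime]
      exact sup_le (h1 (left_ne_zero_of_mul hne)) (h2 (right_ne_zero_of_mul hne))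
  rw [eq_top_iff]
  intro v _
  refine h (minpoly K T) (minpoly.ne_zero (Algebra.IsIntegral.isIntegral T)) ?_
  rw [LinearMap.mem_ker, minpoly.aeval]
  rfl

theorem isInternal_primaryPart [FiniteDimensional K V] (hd : ∀ P Q, Associated P Q → d P = d Q) :
    DirectSum.IsInternal fun q : ℤ => primaryPart d T {q} := by
  refine DirectSum.isInternal_submodule_of_iSupIndep_of_iSup_eq_top ?_
    (iSup_primaryPart hd)
  intro q
  have h := disjoint_primaryPart (d := d) (T := T) (disjoint_compl_right (a := ({q} : Set ℤ)))
  refine h.mono_right (iSup_le fun q' => iSup_le fun hq' => primaryPart_mono ?_)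
  simpa [eq_comm] using hq'

/-- The relation says `(T - p) f = f T`, so `M(T) v = 0` gives `M(T - p) (f v) = 0`. The irreducible
factors of `M(X - p)` are translates of those of `M`, with `d` raised by `p`. -/
theorem map_mem_primaryPart
    (hd : ∀ (p : ℤ) (P : K[X]), 0 < P.natDegree → d (taylor (p : K) P) = d P - p)
    {f : Module.End K V} {p : ℤ} (hf : T * f - f * T = p • f) {q : ℤ} {v : V}
    (hv : v ∈ primaryPart d T {q}) : f v ∈ primaryPart d T {p + q} := by
  obtain ⟨M, hM, hMS, hv⟩ := hv
  have htt (P : K[X]) : taylor (p : K) (taylor (-p : K) P) = P := by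
    rw [taylor_taylor]; simp
  have hdiv (P Q : K[X]) (r : K) (h : P ∣ Q) : taylor r P ∣ taylor r Q := by
    obtain ⟨R, rfl⟩ := h
    exact ⟨taylor r R, taylor_mul r P R⟩
  refine ⟨taylor (-p : K) M, ?_, fun P hP h => ?_, ?_⟩
  · intro h
    exact hM (by rw [← taylor_injective (-p : K) |>.eq_iff, h, map_zero])
  · have h1 := hdiv _ _ (p : K) h
    rw [htt] at h1
    have h2 : d (taylor (p : K) P) ∈ ({q} : Set ℤ) :=
      hMS _ ((MulEquiv.irreducible_iff (taylorEquiv (p : K))).2 hP) h1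
    rw [hd p P hP.natDegree_pos] at h2
    simp only [Set.mem_singleton_iff] at h2 ⊢
    omega
  · have h1 : (T - algebraMap K _ (p : K)) * f = f * T := by
      rw [sub_mul, sub_eq_iff_eq_add, ← sub_eq_iff_eq_add', hf]
      simp
    have h2 (Q : K[X]) : aeval (T - algebraMap K _ (p : K)) Q * f = f * aeval T Q := by
      induction Q using Polynomial.induction_on' with
      | add a b ha hb => rw [map_add, map_add, add_mul, mul_add, ha, hb]
      | monomial n a =>
        have : (T - algebraMap K _ (p : K)) ^ n * f = f * T ^ n :=
          (SemiconjBy.pow_right (show SemiconjBy f T _ from h1.symm) n).eq.symm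
        rw [aeval_monomial, aeval_monomial, mul_assoc, this, ← mul_assoc, ← mul_assoc,
          Algebra.commutes]
    have h3 : aeval T (taylor (-p : K) M) = aeval (T - algebraMap K _ (p : K)) M := by
      rw [taylor_apply, aeval_comp]
      simp [sub_eq_add_neg]
    rw [h3, ← Module.End.mul_apply, h2, Module.End.mul_apply, hv, map_zero]

end IntegralGrading

/-! ### The Euler derivation and the nilradical -/

section GradedLieAlgebra

open DirectSum Polynomial

variable {K : Type u} {L : Type v} [Field K] [LieRing L] [LieAlgebra K L]
variable (ℒ : ℤ → Submodule K L) [GradedLieAlgebra ℒ]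

/-- The linear map acting on `ℒ p` by multiplication with `t ^ p`. -/
noncomputable def torusMap (t : K) : L →ₗ[K] L :=
  DirectSum.toModule K ℤ L (fun p => t ^ p • (ℒ p).subtype) ∘ₗ
    (DirectSum.decomposeLinearEquiv ℒ).toLinearMap

theorem torusMap_apply (t : K) {p : ℤ} {x : L} (hx : x ∈ ℒ p) :
    torusMap ℒ t x = t ^ p • x := by
  lift x to ℒ p using hx
  simp [torusMap]

/-- For `t ≠ 0` the linear map acting on `ℒ p` by `t ^ p` is a homomorphism of Lie algebras. -/
noncomputable def torusHom (t : K) (ht : t ≠ 0) : L →ₗ⁅K⁆ L where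
  __ := torusMap ℒ t
  map_lie' {x y} := by
    change torusMap ℒ t ⁅x, y⁆ = ⁅torusMap ℒ t x, torusMap ℒ t y⁆
    induction x using DirectSum.Decomposition.inductionOn ℒ with
    | zero => simp
    | add a b ha hb => simp only [add_lie, map_add, ha, hb]
    | @homogeneous p a =>
      induction y using DirectSum.Decomposition.inductionOn ℒ with
      | zero => simp
      | add c d hc hd => simp only [lie_add, map_add, hc, hd]
      | @homogeneous q b =>
        rw [torusMap_apply ℒ t (SetLike.GradedBracket.bracket_mem a.2 b.2),
          torusMap_apply ℒ t a.2, torusMap_apply ℒ t b.2, smul_lie, lie_smul, smul_smul,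
          zpow_add₀ ht]

theorem torusMap_inv_torusMap (t : K) (ht : t ≠ 0) (x : L) :
    torusMap ℒ t⁻¹ (torusMap ℒ t x) = x := by
  induction x using DirectSum.Decomposition.inductionOn ℒ with
  | zero => simp
  | add a b ha hb => simp only [map_add, ha, hb]
  | @homogeneous p a =>
    rw [torusMap_apply ℒ t a.2, map_smul, torusMap_apply ℒ _ a.2, smul_smul, inv_zpow,
      mul_inv_cancel₀ (zpow_ne_zero _ ht), one_smul]

theorem mem_nilradical_of_map_mem [CharZero K] [FiniteDimensional K L] (φ : L →ₗ⁅K⁆ L)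
    (hφ : Function.Injective φ) {x : L} (hx : φ x ∈ nilradical K L) : x ∈ nilradical K L := by
  refine (show (nilradical K L).comap φ ≤ nilradical K L from isGreatest_nilradical.2 ?_)
    (LieIdeal.mem_comap.2 hx)
  rw [Set.mem_ofPred_eq, isNilpotent_ideal_iff_forall]
  intro y hy
  obtain ⟨k, hk⟩ := isNilpotent_ad_of_mem_nilradical (LieIdeal.mem_comap.1 hy)
  refine ⟨k, LinearMap.ext fun z => hφ ?_⟩
  have key (n : ℕ) : φ ((LieAlgebra.ad K L y ^ n) z) = (LieAlgebra.ad K L (φ y) ^ n) (φ z) := by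
    induction n with
    | zero => rfl
    | succ n ih =>
      rw [pow_succ', pow_succ', Module.End.mul_apply, Module.End.mul_apply, ← ih]
      simp
  rw [key, hk]
  simp

theorem torusMap_mem_nilradical [CharZero K] [FiniteDimensional K L] (t : K) (ht : t ≠ 0) {x : L}
    (hx : x ∈ nilradical K L) : torusMap ℒ t x ∈ nilradical K L := by
  refine mem_nilradical_of_map_mem (torusHom ℒ t⁻¹ (inv_ne_zero ht)) ?_
    (x := torusMap ℒ t x) ?_
  · refine Function.LeftInverse.injective (g := torusMap ℒ t) fun y => ?_
    have := torusMap_inv_torusMap ℒ t⁻¹ (inv_ne_zero ht) y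
    rwa [inv_inv] at this
  · exact (torusMap_inv_torusMap ℒ t ht x).symm ▸ hx

/-- The derivation acting on `ℒ p` by multiplication with `p`. -/
noncomputable def eulerDerivation : LieDerivation K L L :=
  LieDerivation.ofGrading ℒ (Int.castAddHom K)

theorem eulerDerivation_apply {p : ℤ} {x : L} (hx : x ∈ ℒ p) :
    eulerDerivation ℒ x = (p : K) • x :=
  LieDerivation.ofGrading_apply_apply ℒ _ hx

/-- The nilradical is stable under the automorphism acting by `2 ^ p` in degree `p`. These scalars
are distinct, so on the finitely many degrees occurring in `x` the Euler derivation agrees with a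
Lagrange interpolation polynomial in that automorphism. -/
theorem eulerDerivation_mem_nilradical [CharZero K] [FiniteDimensional K L] {x : L}
    (hx : x ∈ nilradical K L) : eulerDerivation ℒ x ∈ nilradical K L := by
  classical
  have hinj : Function.Injective fun p : ℤ => (2 : K) ^ p := by
    intro p q h
    have h' : ((2 : ℚ) ^ p : ℚ) = 2 ^ q := by
      have h1 : (((2 : ℚ) ^ p : ℚ) : K) = ((2 ^ q : ℚ) : K) := by push_cast; exact h
      exact_mod_cast h1
    exact zpow_right_injective₀ (by norm_num) (by norm_num) h'
  set s := (decompose ℒ x).support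
  set f : K[X] := Lagrange.interpolate s (fun p : ℤ => (2 : K) ^ p) (fun p => (p : K))
  have hf (p : ℤ) (hp : p ∈ s) : f.eval ((2 : K) ^ p) = p :=
    Lagrange.eval_interpolate_at_node _ hinj.injOn hp
  have hpow (n : ℕ) (y : L) (hy : y ∈ nilradical K L) :
      (torusMap ℒ (2 : K) ^ n) y ∈ nilradical K L := by
    induction n with
    | zero => exact hy
    | succ n ih =>
      rw [pow_succ', Module.End.mul_apply]
      exact torusMap_mem_nilradical ℒ 2 two_ne_zero ih
  have haeval (g : K[X]) : aeval (torusMap ℒ (2 : K)) g x ∈ nilradical K L := by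
    induction g using Polynomial.induction_on' with
    | add a b ha hb => rw [map_add, LinearMap.add_apply]; exact add_mem ha hb
    | monomial n a =>
      rw [aeval_monomial, Module.End.mul_apply, Module.algebraMap_end_apply]
      exact (nilradical K L).smul_mem a (hpow n x hx)
  convert haeval f using 1
  rw [← DirectSum.sum_support_decompose ℒ x, map_sum, map_sum]
  refine Finset.sum_congr rfl fun p hp => ?_
  have hmem : (decompose ℒ x p : L) ∈ ℒ p := (decompose ℒ x p).2
  rw [eulerDerivation_apply ℒ hmem, ← hf p hp]
  refine (Module.End.aeval_apply_of_hasEigenvector (f := torusMap ℒ (2 : K)) ⟨?_, ?_⟩).symm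
  · rw [Module.End.mem_eigenspace_iff]
    exact torusMap_apply ℒ 2 hmem
  · simpa [s] using hp

/-- The one-dimensional Lie algebra acting through a derivation. -/
def spanDerivation (D : LieDerivation K L L) : K →ₗ⁅K⁆ LieDerivation K L L where
  __ := LinearMap.toSpanSingleton K (LieDerivation K L L) D
  map_lie' {a b} := by
    change ⁅a, b⁆ • D = ⁅a • D, b • D⁆
    ext x
    simp [LieRing.of_associative_ring_bracket, mul_comm]

open LieAlgebra.SemiDirectSum in
/-- If a derivation `D` preserves the nilradical, then the nilradical of `L` is contained in that
of the semidirect sum of `L` and `K D`. -/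
theorem inl_mem_nilradical [CharZero K] [FiniteDimensional K L] (D : LieDerivation K L L)
    [FiniteDimensional K (L ⋊⁅spanDerivation D⁆ K)]
    (hD : ∀ x ∈ nilradical K L, D x ∈ nilradical K L) {x : L} (hx : x ∈ nilradical K L) :
    inl (spanDerivation D) x ∈ nilradical K (L ⋊⁅spanDerivation D⁆ K) := by
  have hψ (c : K) (y : L) : spanDerivation D c y = c • D y := rfl
  let I : LieIdeal K (L ⋊⁅spanDerivation D⁆ K) :=
    { (nilradical K L).toSubmodule.map (inl (spanDerivation D)).toLinearMap with
      lie_mem := by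
        rintro y _ ⟨z, hz, rfl⟩
        refine ⟨⁅y.left, z⁆ + y.right • D z, ?_, ?_⟩
        · exact add_mem (lie_mem_right K L (nilradical K L) _ _ hz)
            ((nilradical K L).smul_mem _ (hD z hz))
        · change inl (spanDerivation D) _ = ⁅y, inl (spanDerivation D) z⁆
          simp [hψ] }
  refine (show I ≤ nilradical K _ from isGreatest_nilradical.2 ?_) ⟨x, hx, rfl⟩
  rw [Set.mem_ofPred_eq, isNilpotent_ideal_iff_forall]
  rintro _ ⟨z, hz, rfl⟩
  obtain ⟨k, hk⟩ := isNilpotent_ad_of_mem_nilradical hz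
  have h1 (n : ℕ) (w : L) : (LieAlgebra.ad K (L ⋊⁅spanDerivation D⁆ K) (inl _ z) ^ n) (inl _ w) =
      inl (spanDerivation D) ((LieAlgebra.ad K L z ^ n) w) := by
    induction n with
    | zero => rfl
    | succ n ih =>
      rw [pow_succ', pow_succ', Module.End.mul_apply, Module.End.mul_apply, ih,
        LieAlgebra.ad_apply, LieAlgebra.ad_apply, LieHom.map_lie]
  -- One bracket with `z` moves `y` into the copy of `L`; the remaining `k` act there as `ad z`.
  refine ⟨k + 1, LinearMap.ext fun y => ?_⟩
  have h2 : LieAlgebra.ad K (L ⋊⁅spanDerivation D⁆ K) (inl _ z) y =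
      inl (spanDerivation D) (⁅z, y.left⁆ - y.right • D z) := by
    simp [hψ]
  rw [pow_succ, Module.End.mul_apply]
  change (LieAlgebra.ad K (L ⋊⁅spanDerivation D⁆ K) (inl _ z) ^ k)
    (LieAlgebra.ad K (L ⋊⁅spanDerivation D⁆ K) (inl _ z) y) = _
  rw [h2, h1, hk]
  simp

end GradedLieAlgebra

end GradedAdo

/-! ### The graded representation -/

open LieAlgebra.SemiDirectSum in
theorem mainTheorem2 {K : Type u} {L : Type v} [Field K] [CharZero K] [LieRing L] [LieAlgebra K L]
    [FiniteDimensional K L] (ℒ : ℤ → Submodule K L) [GradedLieAlgebra ℒ] :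
    ∃ (V : Type u) (_ : AddCommGroup V) (_ : Module K V) (𝒱 : ℤ → Submodule K V)
      (ρ : L →ₗ⁅K⁆ Module.End K V),
      FiniteDimensional K V ∧
      GradedAdo.IsGradedRepresentation ℒ 𝒱 ρ ∧
      Function.Injective ρ ∧
      ∀ x ∈ GradedAdo.nilradical K L, IsNilpotent (ρ x) := by
  set ψ := GradedAdo.spanDerivation (GradedAdo.eulerDerivation ℒ)
  have : FiniteDimensional K (L ⋊⁅ψ⁆ K) := (toProdl (R := K) ψ).symm.finiteDimensional
  obtain ⟨n, ρ, hρ, hnil⟩ := GradedAdo.exists_faithful_representation (K := K) (L := L ⋊⁅ψ⁆ K)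
  obtain ⟨d, hd, hd'⟩ := GradedAdo.exists_degree_taylor (K := K)
  -- The operator `T = ρ (inr ψ 1)` represents the adjoined Euler element; its primary parts,
  -- indexed by `d`, are the graded pieces.
  refine ⟨Fin n → K, inferInstance, inferInstance,
    fun q => GradedAdo.primaryPart d (ρ (inr ψ 1)) {q}, ρ.comp (inl ψ), inferInstance,
    ⟨GradedAdo.isInternal_primaryPart hd, fun p q x hx v hv => ?_⟩,
    hρ.comp (inl_injective ψ), fun x hx => hnil _ ?_⟩
  · refine GradedAdo.map_mem_primaryPart hd' ?_ hv
    rw [← LieRing.of_associative_ring_bracket, LieHom.comp_apply, ← LieHom.map_lie,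
      ← Int.cast_smul_eq_zsmul K, ← map_smul]
    congr 1
    have : ψ 1 x = (p : K) • x := by
      rw [← GradedAdo.eulerDerivation_apply ℒ hx]
      exact one_smul K _
    simp [this]
  · exact GradedAdo.inl_mem_nilradical _
      (fun _ h => GradedAdo.eulerDerivation_mem_nilradical ℒ h) hx
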